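/- Let $d\ge 2$ and let $\Omega\subset\mathbb R^d$ be a nonempty bounded open set (for instance a bounded domain; connectedness is not needed). Let $0<\lambda_1\le\lambda_2\le\dots$ be the eigenvalues, repeated according to multiplicity, of the Dirichlet Laplacian $-\Delta$ on $\Omega$ (the self-adjoint operator in $L^2(\Omega)$ associated with the form $\int_\Omega\nabla u\cdot\overline{\nabla v}\,dx$ on $H^1_0(\Omega)$). Let $0\neq\phi\in H^1_0(\Omega)\cap L^\infty(\Omega)$ (complex-valued functions allowed), and put $$G(\phi)=\frac{\|\nabla\phi\|_2^2}{\|\phi\|_2^2},\qquad \rho(\phi)=\frac{\|\phi\|_2^2}{|\Omega|\,\|\phi\|_\infty^2},\qquad C_d=4\pi^2\omega_d^{-2/d},\qquad \omega_d=\frac{\pi^{d/2}}{\Gamma(1+d/2)}.$$ Let $k\ge 1$ be an integer with $\lambda_k\ge G(\phi)$. Then $$G(\phi)+C_d\left(\frac{k}{|\Omega|}\right)^{2/d}\rho(\phi)^{-2/d}\,x_-\;\le\;\lambda_k\;\le\;\lambda_{k+1}\;\le\;G(\phi)+C_d\left(\frac{k}{|\Omega|}\right)^{2/d}\rho(\phi)^{-2/d}\,x_+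 ,$$ where $$x_\pm=1\pm\sqrt{1-\frac{\frac{d+2}{d}\left(\frac1k\sum_{j=1}^k\lambda_j-G(\phi)\right)}{C_d\left(\frac{k}{|\Omega|}\right)^{2/d}\rho(\phi)^{-2/d}}}$$ and the expression under the square root is nonnegative. -/

import Mathlib

open MeasureTheory
open scoped ENNReal ContDiff

noncomputable section

namespace DirichletLaplacian

/-- The Hilbert space `L²(Ω; ℂ)`. -/
abbrev L2 {d : ℕ} (Ω : Set (EuclideanSpace ℝ (Fin d))) : Type :=
  Lp ℂ 2 (volume.restrict Ω)

/-- The Hilbert space `L²(Ω; ℂᵈ)` of square integrable vector fields (`ℂᵈ` has its Euclidean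
norm). -/
abbrev L2Vec {d : ℕ} (Ω : Set (EuclideanSpace ℝ (Fin d))) : Type :=
  Lp (EuclideanSpace ℂ (Fin d)) 2 (volume.restrict Ω)

/-- The classical gradient of a complex-valued function. -/
def grad {d : ℕ} (ψ : EuclideanSpace ℝ (Fin d) → ℂ) (x : EuclideanSpace ℝ (Fin d)) :
    EuclideanSpace ℂ (Fin d) :=
  WithLp.toLp 2 fun i => fderiv ℝ ψ x (EuclideanSpace.single i 1)

/-- The space `C_c^∞(Ω)` of smooth functions with compact support contained in `Ω`. -/
def IsTestFunction {d : ℕ} (Ω : Set (EuclideanSpace ℝ (Fin d)))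
    (ψ : EuclideanSpace ℝ (Fin d) → ℂ) : Prop :=
  ContDiff ℝ ∞ ψ ∧ HasCompactSupport ψ ∧ tsupport ψ ⊆ Ω

theorem IsTestFunction.zero {d : ℕ} (Ω : Set (EuclideanSpace ℝ (Fin d))) :
    IsTestFunction Ω (fun _ => 0) :=
  ⟨contDiff_const, HasCompactSupport.zero, by simp [tsupport]⟩

theorem IsTestFunction.add {d : ℕ} {Ω : Set (EuclideanSpace ℝ (Fin d))}
    {ψ χ : EuclideanSpace ℝ (Fin d) → ℂ} (hψ : IsTestFunction Ω ψ) (hχ : IsTestFunction Ω χ) :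
    IsTestFunction Ω (ψ + χ) :=
  ⟨hψ.1.add hχ.1, hψ.2.1.add hχ.2.1,
    (tsupport_add ψ χ).trans (Set.union_subset hψ.2.2 hχ.2.2)⟩

theorem IsTestFunction.smul {d : ℕ} {Ω : Set (EuclideanSpace ℝ (Fin d))}
    {ψ : EuclideanSpace ℝ (Fin d) → ℂ} (c : ℂ) (hψ : IsTestFunction Ω ψ) :
    IsTestFunction Ω (c • ψ) :=
  ⟨hψ.1.const_smul c, hψ.2.1.smul_left (f := fun _ => c),
    (tsupport_smul_subset_right (fun _ => c) ψ).trans hψ.2.2⟩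

theorem grad_add {d : ℕ} {Ω : Set (EuclideanSpace ℝ (Fin d))}
    {ψ χ : EuclideanSpace ℝ (Fin d) → ℂ} (hψ : IsTestFunction Ω ψ) (hχ : IsTestFunction Ω χ) :
    grad (ψ + χ) = grad ψ + grad χ := by
  funext x
  ext i
  simp [grad, fderiv_add (hψ.1.differentiable (by simp) x) (hχ.1.differentiable (by simp) x)]

theorem grad_smul {d : ℕ} {Ω : Set (EuclideanSpace ℝ (Fin d))}
    {ψ : EuclideanSpace ℝ (Fin d) → ℂ} (c : ℂ) (hψ : IsTestFunction Ω ψ) :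
    grad (c • ψ) = c • grad ψ := by
  funext x
  ext i
  simp [grad, fderiv_const_smul (hψ.1.differentiable (by simp) x) c]

/-- The set of pairs `(ψ, ∇ψ)`, `ψ ∈ C_c^∞(Ω)`, in `L²(Ω) × L²(Ω; ℂᵈ)`. The Hilbert sum carries
the norm `(‖u‖₂² + ‖g‖₂²)^{1/2}`, which on these pairs is the `H¹` norm of `ψ`. -/
def testGraph {d : ℕ} (Ω : Set (EuclideanSpace ℝ (Fin d))) :
    Submodule ℂ (WithLp 2 (L2 Ω × L2Vec Ω)) where
  carrier := {p | ∃ ψ : EuclideanSpace ℝ (Fin d) → ℂ, IsTestFunction Ω ψ ∧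
    p.fst =ᵐ[volume.restrict Ω] ψ ∧ p.snd =ᵐ[volume.restrict Ω] grad ψ}
  zero_mem' := by
    refine ⟨fun _ => 0, IsTestFunction.zero Ω, Lp.coeFn_zero _ _ _, ?_⟩
    refine (Lp.coeFn_zero _ _ _).trans (Filter.Eventually.of_forall fun x => ?_)
    ext i
    simp [grad]
  add_mem' := by
    rintro p q ⟨ψ, hψ, hp, hp'⟩ ⟨χ, hχ, hq, hq'⟩
    refine ⟨ψ + χ, hψ.add hχ, (Lp.coeFn_add _ _).trans (hp.add hq), ?_⟩
    rw [grad_add hψ hχ]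
    exact (Lp.coeFn_add _ _).trans (hp'.add hq')
  smul_mem' := by
    rintro c p ⟨ψ, hψ, hp, hp'⟩
    refine ⟨c • ψ, hψ.smul c, (Lp.coeFn_smul _ _).trans (hp.const_smul c), ?_⟩
    rw [grad_smul c hψ]
    exact (Lp.coeFn_smul _ _).trans (hp'.const_smul c)

/-- The Sobolev space `H¹₀(Ω)`: the closure of `C_c^∞(Ω)` in the `H¹` norm. An element `u` is
stored as the pair of the function `u.1.fst ∈ L²(Ω)` and its weak gradient
`u.1.snd ∈ L²(Ω; ℂᵈ)`. -/
def H10 {d : ℕ} (Ω : Set (EuclideanSpace ℝ (Fin d))) :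
    Submodule ℂ (WithLp 2 (L2 Ω × L2Vec Ω)) :=
  (testGraph Ω).topologicalClosure

/-- The element of `L²(Ω)` underlying an element of `H¹₀(Ω)`. -/
def toL2 {d : ℕ} {Ω : Set (EuclideanSpace ℝ (Fin d))} (u : H10 Ω) : L2 Ω :=
  u.1.fst

/-- The weak gradient of an element of `H¹₀(Ω)`. -/
def weakGrad {d : ℕ} {Ω : Set (EuclideanSpace ℝ (Fin d))} (u : H10 Ω) : L2Vec Ω :=
  u.1.snd

/-- `u` lies in the operator domain of the Dirichlet Laplacian `-Δ`, the self-adjoint operator of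
the form `∫ ∇u · ∇v̄` with form domain `H¹₀(Ω)`, and `-Δ u = f`. -/
def NegLaplacianEq {d : ℕ} {Ω : Set (EuclideanSpace ℝ (Fin d))} (u : H10 Ω) (f : L2 Ω) : Prop :=
  ∀ v : H10 Ω, inner ℂ (weakGrad v) (weakGrad u) = inner ℂ (toL2 v) f

/-- `u` is an eigenfunction of the Dirichlet Laplacian with eigenvalue `μ`: `-Δ u = μ u`,
`u ≠ 0`. -/
def IsEigenfunction {d : ℕ} {Ω : Set (EuclideanSpace ℝ (Fin d))} (u : H10 Ω) (μ : ℝ) : Prop :=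
  toL2 u ≠ 0 ∧ NegLaplacianEq u ((μ : ℂ) • toL2 u)

/-- The `k`-th eigenvalue `λ_k` (`k = 1, 2, …`) of the Dirichlet Laplacian on `Ω`, in increasing
order and counted with multiplicity: the least `t` such that there are `k` linearly independent
eigenfunctions with eigenvalues at most `t`. -/
def eigenvalue {d : ℕ} (Ω : Set (EuclideanSpace ℝ (Fin d))) (k : ℕ) : ℝ :=
  sInf {t : ℝ | ∃ (u : Fin k → H10 Ω) (μ : Fin k → ℝ),
    LinearIndependent ℂ (fun i => toL2 (u i)) ∧ ∀ i, IsEigenfunction (u i) (μ i) ∧ μ i ≤ t}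

/-- The mean `(1/k) ∑_{j=1}^k λ_j`. -/
def eigenvalueMean {d : ℕ} (Ω : Set (EuclideanSpace ℝ (Fin d))) (k : ℕ) : ℝ :=
  1 / (k : ℝ) * ∑ j ∈ Finset.Icc 1 k, eigenvalue Ω j

/-- The volume `ω_d = π^{d/2} / Γ(1 + d/2)` of the unit ball in `ℝᵈ`. -/
def unitBallVolume (d : ℕ) : ℝ :=
  Real.pi ^ ((d : ℝ) / 2) / Real.Gamma (1 + (d : ℝ) / 2)

/-- The classical constant `C_d = 4π² ω_d^{-2/d}`. -/
def classicalConst (d : ℕ) : ℝ :=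
  4 * Real.pi ^ 2 * unitBallVolume d ^ (-(2 / (d : ℝ)))

/-- The norm `‖φ‖_∞` (meaningful for `φ ∈ L^∞(Ω)`). -/
def supNorm {d : ℕ} {Ω : Set (EuclideanSpace ℝ (Fin d))} (φ : H10 Ω) : ℝ :=
  (eLpNorm (toL2 φ) ∞ (volume.restrict Ω)).toReal

/-- The Rayleigh quotient `‖∇φ‖₂² / ‖φ‖₂²`. -/
def rayleigh {d : ℕ} {Ω : Set (EuclideanSpace ℝ (Fin d))} (φ : H10 Ω) : ℝ :=
  ‖weakGrad φ‖ ^ 2 / ‖toL2 φ‖ ^ 2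

/-- `ρ(φ) = ‖φ‖₂² / (|Ω| ‖φ‖_∞²)`. -/
def rho {d : ℕ} {Ω : Set (EuclideanSpace ℝ (Fin d))} (φ : H10 Ω) : ℝ :=
  ‖toL2 φ‖ ^ 2 / (volume.real Ω * supNorm φ ^ 2)

/-- The scale `C_d (k/|Ω|)^{2/d} ρ(φ)^{-2/d}`. -/
def weylScale {d : ℕ} {Ω : Set (EuclideanSpace ℝ (Fin d))} (φ : H10 Ω) (k : ℕ) : ℝ :=
  classicalConst d * ((k : ℝ) / volume.real Ω) ^ (2 / (d : ℝ)) * rho φ ^ (-(2 / (d : ℝ)))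

/-- The number `1 - ((d+2)/d) ((1/k) ∑_{j=1}^k λ_j - ‖∇φ‖₂²/‖φ‖₂²) / (C_d (k/|Ω|)^{2/d} ρ(φ)^{-2/d})`
under the square root in `x_±`. -/
def radicand {d : ℕ} {Ω : Set (EuclideanSpace ℝ (Fin d))} (φ : H10 Ω) (k : ℕ) : ℝ :=
  1 - (((d : ℝ) + 2) / (d : ℝ) * (eigenvalueMean Ω k - rayleigh φ)) / weylScale φ k

/-- `x_+`. -/
def xPlus {d : ℕ} {Ω : Set (EuclideanSpace ℝ (Fin d))} (φ : H10 Ω) (k : ℕ) : ℝ :=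
  1 + √(radicand φ k)

/-- `x_-`. -/
def xMinus {d : ℕ} {Ω : Set (EuclideanSpace ℝ (Fin d))} (φ : H10 Ω) (k : ℕ) : ℝ :=
  1 - √(radicand φ k)

end DirichletLaplacian

end

noncomputable section

namespace DirichletLaplacian

/-! Let `u_j` be orthonormal eigenfunctions for `λ_j`, write `G` for the Rayleigh quotient of `φ`,
and let `λ_k ≤ z ≤ λ_{k+1}`. Removing from `f` its projection onto `u_1, …, u_k` leaves a function
`w` with `z‖w‖² ≤ ‖∇w‖²`, so `z‖f‖² - ‖∇f‖² ≤ ∑_{j ≤ k} (z - λ_j) |⟨u_j, f⟩|²`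
(`IsMinimizingFamily.mul_norm_sq_sub_le`).

Take `f = exp(2πi x·ξ) φ`. Averaging over `±ξ` turns the left side into `(z - G - 4π²|ξ|²)‖φ‖²`. Now
integrate over a ball of frequencies. By Plancherel, each `|⟨u_j, f⟩|²` has integral at most
`‖φ‖_∞²` over all `ξ` (`IsMinimizingFamily.setIntegral_ball_le`). The best ball is `4π²|ξ|² < z -
G`. With `S` the Weyl scale, `y = (z - G)/S` and `m = (mean - G)/S`, it yields `2/(d+2) · y^{1+d/2}
≤ y - m` (`IsMinimizingFamily.rpow_le`). Bernoulli's inequality for `y^{d/2}` makes this `(y - 1)² ≤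
1 - (d+2)/d · m`, whose right side is the radicand (`sub_one_sq_le_of_rpow_le`). The choice `z =
λ_k` gives the lower bound and `z = λ_{k+1}` the upper one.

The eigenfunctions come from successive minimization of the Rayleigh quotient
(`exists_isMinimizingFamily`). This needs the compact embedding of `H¹₀` in `L²`, proved by Fourier
analysis (`isCompactOperator_toL2L`), and the infinite dimension of `H¹₀`. The minimal values are
then matched with `eigenvalue` (`IsMinimizingFamily.eigenvalue_eq`). -/

theorem complex_inner_self {E : Type*} [NormedAddCommGroup E] [InnerProductSpace ℂ E] (x : E) :
    inner ℂ x x = ((‖x‖ ^ 2 : ℝ) : ℂ) := by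
  rw [inner_self_eq_norm_sq_to_K]; norm_cast

theorem L2_norm_sq {F : Type*} [NormedAddCommGroup F] [InnerProductSpace ℂ F] {α : Type*}
    [MeasurableSpace α] {μ : Measure α} (f : Lp F 2 μ) : ‖f‖ ^ 2 = ∫ x, ‖f x‖ ^ 2 ∂μ := by
  have h := complex_inner_self f
  rw [L2.inner_def] at h
  simp only [complex_inner_self] at h
  rw [integral_complex_ofReal] at h
  exact_mod_cast h.symm

/-! ### Spectral theory of a form with compact embedding -/

section FormSpectrum

variable {H L G : Type*} [NormedAddCommGroup H] [InnerProductSpace ℂ H]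
  [NormedAddCommGroup L] [InnerProductSpace ℂ L]
  [NormedAddCommGroup G] [InnerProductSpace ℂ G]

/-- A nonzero compact operator between Hilbert spaces attains its norm, at an eigenvector
of `T†T`. -/
theorem exists_adjoint_comp_self_eigenvector [CompleteSpace H] [CompleteSpace L]
    (T : H →L[ℂ] L) (hT : IsCompactOperator T)
    (hT0 : T ≠ 0) :
    0 < ‖T‖ ∧ ∃ x : H, x ≠ 0 ∧ ∀ v, inner ℂ (T v) (T x) = ((‖T‖ ^ 2 : ℝ) : ℂ) * inner ℂ v x := by
  set κ := ‖T‖ with hκ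
  have hκ0 : 0 < κ := norm_pos_iff.2 hT0
  have hseq : ∀ n : ℕ, ∃ x : H, ‖x‖ ≤ 1 ∧ κ - 1 / ((n : ℝ) + 1) < ‖T x‖ := by
    intro n
    by_contra! hcon
    have hmax : ‖T‖ ≤ max 0 (κ - 1 / ((n : ℝ) + 1)) := by
      refine T.opNorm_le_of_unit_norm (𝕜 := ℂ) (le_max_left _ _) ?_
      intro x hx
      exact (hcon x hx.le).trans (le_max_right _ _)
    have h1 : (0 : ℝ) < 1 / ((n : ℝ) + 1) := by positivity
    rcases le_max_iff.1 hmax with h | h <;> linarith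
  choose x hx1 hx2 using hseq
  set A := ContinuousLinearMap.adjoint T ∘L T with hA
  have hAc : IsCompactOperator A := by
    have := hT.clm_comp (ContinuousLinearMap.adjoint T)
    exact this
  have hAn : ‖A‖ ≤ κ ^ 2 := by
    refine (ContinuousLinearMap.opNorm_comp_le _ _).trans ?_
    rw [LinearIsometryEquiv.norm_map, sq]
  have hcomp := hAc.isCompact_closure_image_closedBall 1
  obtain ⟨y, -, s, hs, hy⟩ := hcomp.tendsto_subseq (x := fun n => A (x n)) (fun n =>
    subset_closure ⟨x n, by simpa using hx1 n, rfl⟩)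
  have hlim : Filter.Tendsto (fun n : ℕ => κ - 1 / ((n : ℝ) + 1)) Filter.atTop (nhds κ) := by
    simpa using tendsto_const_nhds.sub (tendsto_one_div_add_atTop_nhds_zero_nat (𝕜 := ℝ))
  have hTx : Filter.Tendsto (fun n => ‖T (x n)‖) Filter.atTop (nhds κ) := by
    refine tendsto_of_tendsto_of_tendsto_of_le_of_le hlim tendsto_const_nhds
      (fun n => (hx2 n).le) (fun n => ?_)
    exact (T.le_opNorm _).trans (by nlinarith [hx1 n])
  -- A norming sequence consists of approximate eigenvectors of `A = T†T`: expand the square and use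
  -- `⟨A x, x⟩ = ‖T x‖²`, which tends to `κ²`.
  have hdiff : ∀ n, ‖A (x n) - ((κ ^ 2 : ℝ) : ℂ) • x n‖ ^ 2
      ≤ 2 * κ ^ 4 - 2 * κ ^ 2 * ‖T (x n)‖ ^ 2 := by
    intro n
    have e1 : inner ℂ (A (x n)) (x n) = ((‖T (x n)‖ ^ 2 : ℝ) : ℂ) := by
      rw [hA, ContinuousLinearMap.comp_apply, ContinuousLinearMap.adjoint_inner_left,
        complex_inner_self]
    rw [norm_sub_sq (𝕜 := ℂ), inner_smul_right, e1, norm_smul]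
    have h1 : ‖A (x n)‖ ≤ κ ^ 2 :=
      (A.le_opNorm _).trans (by nlinarith [hx1 n, norm_nonneg A, norm_nonneg (x n)])
    have h2 : ‖A (x n)‖ ^ 2 ≤ (κ ^ 2) ^ 2 := by gcongr
    have h3 : ‖x n‖ ^ 2 ≤ 1 := by nlinarith [hx1 n, norm_nonneg (x n)]
    have h4 : RCLike.re (((κ ^ 2 : ℝ) : ℂ) * ((‖T (x n)‖ ^ 2 : ℝ) : ℂ))
        = κ ^ 2 * ‖T (x n)‖ ^ 2 := by
      rw [← Complex.ofReal_mul]; exact Complex.ofReal_re _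
    rw [h4, Complex.norm_real, mul_pow, Real.norm_eq_abs, sq_abs]
    nlinarith [mul_le_mul_of_nonneg_left h3 (by positivity : (0 : ℝ) ≤ (κ ^ 2) ^ 2)]
  have hdiff0 : Filter.Tendsto (fun n => A (x n) - ((κ ^ 2 : ℝ) : ℂ) • x n) Filter.atTop
      (nhds 0) := by
    rw [tendsto_zero_iff_norm_tendsto_zero]
    have h0 : Filter.Tendsto (fun n => 2 * κ ^ 4 - 2 * κ ^ 2 * ‖T (x n)‖ ^ 2) Filter.atTop
        (nhds 0) := by
      have := (hTx.pow 2).const_mul (2 * κ ^ 2) |>.const_sub (2 * κ ^ 4)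
      convert this using 2; ring
    have h1 := squeeze_zero (fun n => sq_nonneg _) hdiff h0
    have h2 := h1.sqrt
    simpa [Real.sqrt_sq] using h2
  have hκc : ((κ ^ 2 : ℝ) : ℂ) ≠ 0 := by
    exact_mod_cast (pow_pos hκ0 2).ne'
  -- Compactness only makes `A (x (s n))` converge; since `κ ≠ 0`, the approximate eigenvalue
  -- equation makes `x (s n)` converge too.
  have hxs : Filter.Tendsto (fun n => x (s n)) Filter.atTop
      (nhds (((κ ^ 2 : ℝ) : ℂ)⁻¹ • y)) := by
    have h1 := (hy.sub (hdiff0.comp hs.tendsto_atTop)).const_smul (((κ ^ 2 : ℝ) : ℂ)⁻¹)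
    rw [sub_zero] at h1
    refine h1.congr fun n => ?_
    simp only [Function.comp_apply, sub_sub_cancel]
    rw [smul_smul, inv_mul_cancel₀ hκc, one_smul]
  set w := ((κ ^ 2 : ℝ) : ℂ)⁻¹ • y with hw
  have hAw : A w = ((κ ^ 2 : ℝ) : ℂ) • w := by
    have h1 : Filter.Tendsto (fun n => A (x (s n))) Filter.atTop (nhds (A w)) :=
      (A.continuous.tendsto _).comp hxs
    rw [tendsto_nhds_unique h1 hy, hw, smul_smul, mul_inv_cancel₀ hκc, one_smul]
  have hTw : ‖T w‖ = κ := by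
    have h1 : Filter.Tendsto (fun n => ‖T (x (s n))‖) Filter.atTop (nhds ‖T w‖) :=
      ((T.continuous.tendsto _).comp hxs).norm
    exact tendsto_nhds_unique h1 (hTx.comp hs.tendsto_atTop)
  refine ⟨hκ0, w, ?_, fun v => ?_⟩
  · intro h
    rw [h, map_zero, norm_zero] at hTw
    exact hκ0.ne hTw
  · rw [← ContinuousLinearMap.adjoint_inner_right, ← inner_smul_right, ← hAw]
    rfl

variable (ι : H →L[ℂ] L) (D : H →L[ℂ] G)

/-- `u` solves `-Δ u = μ u` weakly, in the abstract form setting. -/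
def IsFormEigenvector (u : H) (μ : ℝ) : Prop :=
  ∀ v, inner ℂ (D v) (D u) = (μ : ℂ) * inner ℂ (ι v) (ι u)

/-- `u i`, `i < n`, are successive minimizers of the Rayleigh quotient `‖D f‖² / ‖ι f‖²` with
minimal values `μ i`. -/
def IsMinimizingFamily (n : ℕ) (u : ℕ → H) (μ : ℕ → ℝ) : Prop :=
  ∀ i < n, ‖ι (u i)‖ = 1 ∧ (∀ j < i, inner ℂ (ι (u j)) (ι (u i)) = 0) ∧
    IsFormEigenvector ι D (u i) (μ i) ∧
    ∀ f, (∀ j < i, inner ℂ (ι (u j)) (ι f) = 0) → μ i * ‖ι f‖ ^ 2 ≤ ‖D f‖ ^ 2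

variable {ι D} {n : ℕ} {u : ℕ → H} {μ : ℕ → ℝ}

theorem IsMinimizingFamily.mono (h : IsMinimizingFamily ι D n u μ) {m : ℕ} (hm : m ≤ n) :
    IsMinimizingFamily ι D m u μ := fun i hi => h i (hi.trans_le hm)

theorem IsMinimizingFamily.inner_eq (h : IsMinimizingFamily ι D n u μ) {i j : ℕ} (hi : i < n)
    (hj : j < n) : inner ℂ (ι (u i)) (ι (u j)) = if i = j then 1 else 0 := by
  split_ifs with hij
  · subst hij
    rw [complex_inner_self, (h i hi).1]; simp
  · rcases lt_or_gt_of_ne hij with h' | h'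
    · exact (h j hj).2.1 i h'
    · exact inner_eq_zero_symm.1 ((h i hi).2.1 j h')

theorem IsMinimizingFamily.le (h : IsMinimizingFamily ι D n u μ) {i j : ℕ} (hij : i ≤ j)
    (hj : j < n) : μ i ≤ μ j := by
  have h1 := (h i (hij.trans_lt hj)).2.2.2 (u j) (fun l hl => by
    rw [h.inner_eq (by omega) hj, if_neg (by omega)])
  have h2 := (h j hj).2.2.1 (u j)
  rw [complex_inner_self, complex_inner_self, (h j hj).1] at h2
  have h3 : ‖D (u j)‖ ^ 2 = μ j := by
    have : ((‖D (u j)‖ ^ 2 : ℝ) : ℂ) = (μ j : ℂ) := by simpa using h2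
    exact_mod_cast this
  rw [h3, (h j hj).1] at h1
  simpa using h1

/-- The projection of `f` onto the span of the first `n` minimizers. -/
def spectralProj (ι : H →L[ℂ] L) (n : ℕ) (u : ℕ → H) (f : H) : H :=
  ∑ j ∈ Finset.range n, inner ℂ (ι (u j)) (ι f) • u j

theorem IsMinimizingFamily.inner_spectralProj (h : IsMinimizingFamily ι D n u μ) (f : H) {i : ℕ}
    (hi : i < n) :
    inner ℂ (ι (u i)) (ι (spectralProj ι n u f)) = inner ℂ (ι (u i)) (ι f) := by
  simp only [spectralProj, map_sum, map_smul, inner_sum, inner_smul_right]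
  rw [Finset.sum_eq_single i]
  · rw [h.inner_eq hi hi]; simp
  · intro j hj hji
    rw [h.inner_eq hi (Finset.mem_range.1 hj), if_neg hji.symm, mul_zero]
  · intro h'; exact absurd (Finset.mem_range.2 hi) h'

theorem IsMinimizingFamily.inner_sub_spectralProj (h : IsMinimizingFamily ι D n u μ) (f : H)
    {i : ℕ} (hi : i < n) : inner ℂ (ι (u i)) (ι (f - spectralProj ι n u f)) = 0 := by
  rw [map_sub, inner_sub_right, h.inner_spectralProj f hi, sub_self]

theorem IsMinimizingFamily.norm_sq_eq (h : IsMinimizingFamily ι D n u μ) (f : H) :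
    ‖ι f‖ ^ 2 = ‖ι (f - spectralProj ι n u f)‖ ^ 2 +
      ∑ j ∈ Finset.range n, ‖inner ℂ (ι (u j)) (ι f)‖ ^ 2 := by
  set s := spectralProj ι n u f with hs
  have h0 : inner ℂ (ι (f - s)) (ι s) = 0 := by
    conv_lhs => enter [3]; rw [hs]
    conv_lhs => simp only [spectralProj, map_sum, map_smul, inner_sum, inner_smul_right]
    refine Finset.sum_eq_zero fun j hj => ?_
    have := h.inner_sub_spectralProj f (Finset.mem_range.1 hj)
    rw [inner_eq_zero_symm.1 this, mul_zero]
  have h1 : inner ℂ (ι s) (ι s) = ((∑ j ∈ Finset.range n,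
      ‖inner ℂ (ι (u j)) (ι f)‖ ^ 2 : ℝ) : ℂ) := by
    conv_lhs => enter [3]; rw [hs]
    conv_lhs => simp only [spectralProj, map_sum, map_smul, inner_sum, inner_smul_right]
    push_cast
    refine Finset.sum_congr rfl fun j hj => ?_
    rw [← inner_conj_symm (ι s), hs, h.inner_spectralProj f (Finset.mem_range.1 hj), RCLike.mul_conj]
    norm_cast
  have h2 : ‖ι s‖ ^ 2 = ∑ j ∈ Finset.range n, ‖inner ℂ (ι (u j)) (ι f)‖ ^ 2 := by
    rw [complex_inner_self] at h1
    exact_mod_cast h1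
  have h3 : ι f = ι (f - s) + ι s := by rw [← map_add, sub_add_cancel]
  rw [h3, norm_add_sq (𝕜 := ℂ), h0, h2]
  simp

/-- The weak equation turns `ι`-orthogonality to an eigenvector into `D`-orthogonality, so
Pythagoras holds for the energy as well, with weights `μ j`. -/
theorem IsMinimizingFamily.norm_grad_sq_eq (h : IsMinimizingFamily ι D n u μ) (f : H) :
    ‖D f‖ ^ 2 = ‖D (f - spectralProj ι n u f)‖ ^ 2 +
      ∑ j ∈ Finset.range n, μ j * ‖inner ℂ (ι (u j)) (ι f)‖ ^ 2 := by
  set s := spectralProj ι n u f with hs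
  have h0 : inner ℂ (D (f - s)) (D s) = 0 := by
    conv_lhs => enter [3]; rw [hs]
    conv_lhs => simp only [spectralProj, map_sum, map_smul, inner_sum, inner_smul_right]
    refine Finset.sum_eq_zero fun j hj => ?_
    rw [(h j (Finset.mem_range.1 hj)).2.2.1, hs,
      inner_eq_zero_symm.1 (h.inner_sub_spectralProj f (Finset.mem_range.1 hj)), mul_zero,
      mul_zero]
  have h1 : inner ℂ (D s) (D s) = ((∑ j ∈ Finset.range n,
      μ j * ‖inner ℂ (ι (u j)) (ι f)‖ ^ 2 : ℝ) : ℂ) := by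
    conv_lhs => enter [3]; rw [hs]
    conv_lhs => simp only [spectralProj, map_sum, map_smul, inner_sum, inner_smul_right]
    push_cast
    refine Finset.sum_congr rfl fun j hj => ?_
    rw [(h j (Finset.mem_range.1 hj)).2.2.1, ← inner_conj_symm (ι s), hs,
      h.inner_spectralProj f (Finset.mem_range.1 hj), mul_left_comm, RCLike.mul_conj]
    simp
  have h2 : ‖D s‖ ^ 2 = ∑ j ∈ Finset.range n, μ j * ‖inner ℂ (ι (u j)) (ι f)‖ ^ 2 := by
    rw [complex_inner_self] at h1
    exact_mod_cast h1
  have h3 : D f = D (f - s) + D s := by rw [← map_add, sub_add_cancel]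
  rw [h3, norm_add_sq (𝕜 := ℂ), h0, h2]
  simp

/-- The averaged variational principle, before averaging. -/
theorem IsMinimizingFamily.mul_norm_sq_sub_le (h : IsMinimizingFamily ι D (n + 1) u μ) {z : ℝ}
    (hz : z ≤ μ n) (f : H) :
    z * ‖ι f‖ ^ 2 - ‖D f‖ ^ 2 ≤
      ∑ j ∈ Finset.range n, (z - μ j) * ‖inner ℂ (ι (u j)) (ι f)‖ ^ 2 := by
  have hn := h.mono (Nat.le_succ n)
  have h1 := (h n (Nat.lt_succ_self n)).2.2.2 (f - spectralProj ι n u f)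
    (fun j hj => hn.inner_sub_spectralProj f hj)
  rw [hn.norm_sq_eq f, hn.norm_grad_sq_eq f]
  simp only [sub_mul, Finset.sum_sub_distrib, ← Finset.mul_sum]
  nlinarith [mul_le_mul_of_nonneg_right hz (sq_nonneg ‖ι (f - spectralProj ι n u f)‖)]

/-- A minimizing family can be prolonged as long as the orthogonal complement is nontrivial. -/
theorem IsMinimizingFamily.exists_succ [CompleteSpace H] [CompleteSpace L]
    (hι : IsCompactOperator ι)
    (hinner : ∀ x y : H, inner ℂ x y = inner ℂ (ι x) (ι y) + inner ℂ (D x) (D y))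
    (h : IsMinimizingFamily ι D n u μ)
    (hf : ∃ f, (∀ j < n, inner ℂ (ι (u j)) (ι f) = 0) ∧ ι f ≠ 0) :
    ∃ u' μ', IsMinimizingFamily ι D (n + 1) u' μ' := by
  -- The next minimizer is sought in the closed subspace of the orthogonality constraints, where
  -- minimizing the Rayleigh quotient amounts to norming `ι`.
  let W : Submodule ℂ H :=
    ⨅ j ∈ Finset.range n, LinearMap.ker ((innerSL ℂ (ι (u j)) ∘L ι : H →L[ℂ] ℂ) : H →ₗ[ℂ] ℂ)
  have hW : ∀ f, f ∈ W ↔ ∀ j < n, inner ℂ (ι (u j)) (ι f) = 0 := by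
    intro f; simp [W, Submodule.mem_iInf]
  have hWc : IsClosed (W : Set H) := by
    simp only [W, Submodule.coe_iInf]
    refine isClosed_iInter fun j => isClosed_iInter fun _ => ?_
    exact (innerSL ℂ (ι (u j)) ∘L ι : H →L[ℂ] ℂ).isClosed_ker
  have : CompleteSpace W := hWc.completeSpace_coe
  set T : W →L[ℂ] L := ι ∘L W.subtypeL with hT
  have hTc : IsCompactOperator T := hι.comp_clm W.subtypeL
  obtain ⟨f₀, hf₀, hf₀'⟩ := hf
  have hT0 : T ≠ 0 := by
    intro h0
    apply hf₀'
    have : T ⟨f₀, (hW f₀).2 hf₀⟩ = 0 := by rw [h0]; rfl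
    exact this
  obtain ⟨hκ, x, hx0, hx⟩ := exists_adjoint_comp_self_eigenvector T hTc hT0
  have hxW := (hW x.1).1 x.2
  -- The Euler–Lagrange equation is known for `v ∈ W` only. It extends to all `v` because `x` is
  -- orthogonal to each `u j` both in `L` and in `H`.
  have hx' : ∀ v : H, inner ℂ (ι v) (ι x.1) = ((‖T‖ ^ 2 : ℝ) : ℂ) * inner ℂ v x.1 := by
    intro v
    have hw : v - spectralProj ι n u v ∈ W :=
      (hW _).2 fun j hj => h.inner_sub_spectralProj v hj
    have h1 : inner ℂ (ι (v - spectralProj ι n u v)) (ι x.1)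
        = ((‖T‖ ^ 2 : ℝ) : ℂ) * inner ℂ (v - spectralProj ι n u v) x.1 := hx ⟨_, hw⟩
    have h2 : inner ℂ (ι (spectralProj ι n u v)) (ι x.1) = 0 := by
      simp only [spectralProj, map_sum, map_smul, sum_inner, inner_smul_left]
      exact Finset.sum_eq_zero fun j hj => by rw [hxW j (Finset.mem_range.1 hj), mul_zero]
    have h3 : inner ℂ (spectralProj ι n u v) x.1 = 0 := by
      simp only [spectralProj, sum_inner, inner_smul_left]
      refine Finset.sum_eq_zero fun j hj => ?_
      have hj' := Finset.mem_range.1 hj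
      have : inner ℂ (D (u j)) (D x.1) = 0 := by
        rw [inner_eq_zero_symm, (h j hj').2.2.1, inner_eq_zero_symm.1 (hxW j hj'), mul_zero]
      rw [hinner, hxW j hj', this, add_zero, mul_zero]
    rw [map_sub, inner_sub_left, inner_sub_left, h2, h3, sub_zero, sub_zero] at h1
    exact h1
  have hιx : ι x.1 ≠ 0 := by
    intro h0
    have h1 := hx' x.1
    rw [h0, inner_zero_left] at h1
    rcases mul_eq_zero.1 h1.symm with h2 | h2
    · have : ‖T‖ ^ 2 = 0 := by exact_mod_cast h2
      exact hκ.ne' (pow_eq_zero_iff two_ne_zero |>.1 this)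
    · exact hx0 (Subtype.ext (inner_self_eq_zero.1 h2))
  have hιxn : ‖ι x.1‖ ≠ 0 := norm_ne_zero_iff.2 hιx
  set y : H := ((‖ι x.1‖ : ℂ)⁻¹) • x.1 with hy
  -- From `⟨ι v, ι x⟩ = ‖T‖² ⟨v, x⟩` and `⟨v, x⟩ = ⟨ι v, ι x⟩ + ⟨D v, D x⟩`.
  set ν : ℝ := 1 / ‖T‖ ^ 2 - 1 with hν
  have hκc : ((‖T‖ ^ 2 : ℝ) : ℂ) ≠ 0 := by exact_mod_cast (pow_pos hκ 2).ne'
  have hyeig : IsFormEigenvector ι D y ν := by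
    intro v
    have h1 := hinner v x.1
    have h2 := hx' v
    have h3 : inner ℂ (D v) (D x.1) = (ν : ℂ) * inner ℂ (ι v) (ι x.1) := by
      have : inner ℂ (D v) (D x.1) = inner ℂ v x.1 - inner ℂ (ι v) (ι x.1) := by
        rw [h1]; ring
      rw [this, h2, hν]
      have hκc' : (‖T‖ : ℂ) ≠ 0 := by exact_mod_cast hκ.ne'
      push_cast
      field_simp
    simp only [hy, map_smul, inner_smul_right]
    rw [h3]; ring
  have hy1 : ‖ι y‖ = 1 := by
    rw [hy, map_smul, norm_smul, norm_inv, Complex.norm_real, norm_norm, inv_mul_cancel₀ hιxn]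
  refine ⟨Function.update u n y, Function.update μ n ν, fun i hi => ?_⟩
  rcases Nat.lt_succ_iff_lt_or_eq.1 hi with hi' | rfl
  · have e : ∀ j < n, Function.update u n y j = u j := fun j hj =>
      Function.update_of_ne hj.ne _ _
    rw [e i hi', Function.update_of_ne hi'.ne]
    refine ⟨(h i hi').1, fun j hj => ?_, (h i hi').2.2.1, fun f hf => ?_⟩
    · rw [e j (hj.trans hi')]; exact (h i hi').2.1 j hj
    · refine (h i hi').2.2.2 f fun j hj => ?_
      rw [← e j (hj.trans hi')]; exact hf j hj
  · have e : ∀ j < i, Function.update u i y j = u j := fun j hj =>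
      Function.update_of_ne hj.ne _ _
    rw [Function.update_self, Function.update_self]
    refine ⟨hy1, fun j hj => ?_, hyeig, fun f hf => ?_⟩
    · rw [e j hj, hy, map_smul, inner_smul_right, hxW j hj, mul_zero]
    · have hfW : f ∈ W := (hW f).2 fun j hj => by rw [← e j hj]; exact hf j hj
      have h1 : ‖ι f‖ ≤ ‖T‖ * ‖f‖ := T.le_opNorm ⟨f, hfW⟩
      have h2 : ‖f‖ ^ 2 = ‖ι f‖ ^ 2 + ‖D f‖ ^ 2 := by
        have := hinner f f
        simp only [complex_inner_self] at this
        exact_mod_cast this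
      have h3 : ‖ι f‖ ^ 2 ≤ ‖T‖ ^ 2 * ‖f‖ ^ 2 := by
        rw [← mul_pow]; gcongr
      rw [h2] at h3
      have h4 : ‖ι f‖ ^ 2 / ‖T‖ ^ 2 ≤ ‖ι f‖ ^ 2 + ‖D f‖ ^ 2 := by
        rw [div_le_iff₀ (by positivity)]; linarith
      rw [hν, sub_mul, one_div, inv_mul_eq_div]
      linarith

/-- Any number of successive minimizers exist. -/
theorem exists_isMinimizingFamily [CompleteSpace H] [CompleteSpace L]
    (hι : IsCompactOperator ι)
    (hinner : ∀ x y : H, inner ℂ x y = inner ℂ (ι x) (ι y) + inner ℂ (D x) (D y))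
    (hinf : ∀ (n : ℕ) (u : ℕ → H) (μ : ℕ → ℝ), IsMinimizingFamily ι D n u μ →
      ∃ f, (∀ j < n, inner ℂ (ι (u j)) (ι f) = 0) ∧ ι f ≠ 0) (n : ℕ) :
    ∃ u μ, IsMinimizingFamily ι D n u μ := by
  induction n with
  | zero => exact ⟨0, 0, fun i hi => absurd hi (Nat.not_lt_zero i)⟩
  | succ n ih =>
    obtain ⟨u, μ, h⟩ := ih
    exact h.exists_succ hι hinner (hinf n u μ h)

/-- An eigenvector whose eigenvalue lies below `μ n` is a combination of `u 0, …, u (n - 1)`. -/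
theorem IsMinimizingFamily.mem_span_of_lt (h : IsMinimizingFamily ι D (n + 1) u μ) {v : H}
    {t : ℝ} (hv : IsFormEigenvector ι D v t) (ht : t < μ n) :
    ι v = ι (spectralProj ι n u v) := by
  have hn := h.mono (Nat.le_succ n)
  set w := v - spectralProj ι n u v with hw
  have hw0 : ∀ j < n, inner ℂ (ι (u j)) (ι w) = 0 := fun j hj => hn.inner_sub_spectralProj v hj
  have h1 := (h n (Nat.lt_succ_self n)).2.2.2 w hw0
  have h2 : inner ℂ (D w) (D w) = (t : ℂ) * inner ℂ (ι w) (ι w) := by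
    have e1 : inner ℂ (D w) (D (spectralProj ι n u v)) = 0 := by
      simp only [spectralProj, map_sum, map_smul, inner_sum, inner_smul_right]
      refine Finset.sum_eq_zero fun j hj => ?_
      rw [(hn j (Finset.mem_range.1 hj)).2.2.1,
        inner_eq_zero_symm.1 (hw0 j (Finset.mem_range.1 hj)), mul_zero, mul_zero]
    have e2 : inner ℂ (ι w) (ι (spectralProj ι n u v)) = 0 := by
      simp only [spectralProj, map_sum, map_smul, inner_sum, inner_smul_right]
      refine Finset.sum_eq_zero fun j hj => ?_
      rw [inner_eq_zero_symm.1 (hw0 j (Finset.mem_range.1 hj)), mul_zero]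
    have e3 : inner ℂ (D w) (D w) = inner ℂ (D w) (D v) := by
      conv_lhs => enter [3]; rw [hw, map_sub]
      rw [inner_sub_right, e1, sub_zero]
    have e4 : inner ℂ (ι w) (ι w) = inner ℂ (ι w) (ι v) := by
      conv_lhs => enter [3]; rw [hw, map_sub]
      rw [inner_sub_right, e2, sub_zero]
    rw [e3, e4, hv]
  have h3 : ‖D w‖ ^ 2 = t * ‖ι w‖ ^ 2 := by
    simp only [complex_inner_self] at h2
    exact_mod_cast h2
  -- Minimality gives `μ n * ‖ι w‖² ≤ ‖D w‖² = t * ‖ι w‖²`, while `t < μ n`.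
  have h4 : ‖ι w‖ ^ 2 = 0 := by nlinarith [sq_nonneg ‖ι w‖]
  have h5 : ι w = 0 := by simpa using h4
  rw [hw, map_sub, sub_eq_zero] at h5
  exact h5

end FormSpectrum

/-! ### Plancherel's theorem for the Fourier integral -/

section Plancherel

open FourierTransform SchwartzMap

variable {V : Type*} [NormedAddCommGroup V] [InnerProductSpace ℝ V] [FiniteDimensional ℝ V]
  [MeasurableSpace V] [BorelSpace V]

theorem continuous_fourier_of_integrable {f : V → ℂ} (hf : Integrable f) : Continuous (𝓕 f) :=
  VectorFourier.fourierIntegral_continuous Real.continuous_fourierChar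
    (by exact continuous_inner) hf

/-- The `L²` Fourier transform of an integrable function is given by the Fourier integral. -/
theorem coeFn_fourier_toLp {f : V → ℂ} (hf1 : Integrable f) (hf2 : MemLp f 2) :
    (𝓕 (hf2.toLp f) : Lp ℂ 2 (volume : Measure V)) =ᵐ[volume] 𝓕 f := by
  -- Both sides are compared as distributions: paired with a test function, each Fourier transform
  -- can be moved onto the test function.
  refine ae_eq_of_integral_contDiff_smul_eq
    ((Lp.memLp _).locallyIntegrable (by norm_num))
    (continuous_fourier_of_integrable hf1).locallyIntegrable fun g hg hgs => ?_
  have hgs' : HasCompactSupport (fun x => (g x : ℂ)) :=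
    hgs.comp_left (g := fun x : ℝ => (x : ℂ)) (by simp)
  have hg' : ContDiff ℝ ∞ (fun x => (g x : ℂ)) := Complex.ofRealCLM.contDiff.comp hg
  set G : 𝓢(V, ℂ) := hgs'.toSchwartzMap hg' with hG
  have hGg : ∀ x, G x = (g x : ℂ) := fun x => rfl
  have h1 := congrArg (fun T => T G) (Lp.fourier_toTemperedDistribution_eq (hf2.toLp f))
  simp only [TemperedDistribution.fourier_apply, Lp.toTemperedDistribution_apply] at h1
  have h2 : ∫ x, (𝓕 G) x • (hf2.toLp f) x = ∫ x, (𝓕 (G : V → ℂ)) x • f x := by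
    refine integral_congr_ae ?_
    filter_upwards [hf2.coeFn_toLp] with x hx
    rw [hx, SchwartzMap.fourier_coe]
  have h3 : ∫ x, (𝓕 (G : V → ℂ)) x • f x = ∫ x, G x • (𝓕 f) x := by
    have := VectorFourier.integral_fourierIntegral_smul_eq_flip (e := Real.fourierChar)
      (L := innerₗ V) (μ := (volume : Measure V)) (ν := (volume : Measure V))
      Real.continuous_fourierChar continuous_inner G.integrable hf1
    rw [flip_innerₗ] at this
    exact this
  rw [h2, h3] at h1
  have e : ∀ F : V → ℂ, ∫ x, g x • F x = ∫ x, G x • F x := fun F => by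
    simp [hGg]
  rw [e, e, h1]

theorem memLp_two_fourier {f : V → ℂ} (hf1 : Integrable f) (hf2 : MemLp f 2) :
    MemLp (𝓕 f) 2 :=
  (memLp_congr_ae (coeFn_fourier_toLp hf1 hf2)).1 (Lp.memLp _)

/-- **Plancherel's theorem** for integrable, square integrable functions. -/
theorem integral_norm_fourier_sq {f : V → ℂ} (hf1 : Integrable f) (hf2 : MemLp f 2) :
    ∫ ξ, ‖𝓕 f ξ‖ ^ 2 = ∫ x, ‖f x‖ ^ 2 := by
  have h1 := L2_norm_sq (𝓕 (hf2.toLp f))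
  have h2 := L2_norm_sq (hf2.toLp f)
  rw [Lp.norm_fourier_eq, h2] at h1
  have h3 : ∫ x, ‖(hf2.toLp f) x‖ ^ 2 = ∫ x, ‖f x‖ ^ 2 := by
    refine integral_congr_ae ?_
    filter_upwards [hf2.coeFn_toLp] with x hx
    rw [hx]
  have h4 : ∫ x, ‖(𝓕 (hf2.toLp f) : Lp ℂ 2 (volume : Measure V)) x‖ ^ 2
      = ∫ x, ‖𝓕 f x‖ ^ 2 := by
    refine integral_congr_ae ?_
    filter_upwards [coeFn_fourier_toLp hf1 hf2] with x hx
    rw [hx]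
  rw [← h4, ← h1, h3]

end Plancherel

/-! ### Multiplication by plane waves on `H¹₀(Ω)` -/

section Modulation

open FourierTransform

variable {d : ℕ} {F : Type*} [NormedAddCommGroup F] [NormedSpace ℂ F]
  {μ : Measure (EuclideanSpace ℝ (Fin d))} {Ω : Set (EuclideanSpace ℝ (Fin d))}

/-- The plane wave `x ↦ exp (2πi x · ξ)`. -/
def planeWave (ξ x : EuclideanSpace ℝ (Fin d)) : ℂ := (Real.fourierChar (inner ℝ x ξ) : ℂ)

theorem planeWave_eq_exp (ξ x : EuclideanSpace ℝ (Fin d)) :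
    planeWave ξ x = Complex.exp ((2 * Real.pi * inner ℝ x ξ : ℝ) * Complex.I) := by
  rw [planeWave, Real.fourierChar_apply]

@[simp]
theorem norm_planeWave (ξ x : EuclideanSpace ℝ (Fin d)) : ‖planeWave ξ x‖ = 1 :=
  Circle.norm_coe _

theorem conj_planeWave (ξ x : EuclideanSpace ℝ (Fin d)) :
    (starRingEnd ℂ) (planeWave ξ x) = (Real.fourierChar (-inner ℝ x ξ) : ℂ) := by
  rw [planeWave, ← Circle.coe_inv_eq_conj, AddChar.map_neg_eq_inv]

theorem contDiff_planeWave (ξ : EuclideanSpace ℝ (Fin d)) : ContDiff ℝ ∞ (planeWave ξ) := by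
  have : planeWave ξ = fun x => Complex.exp ((2 * Real.pi * inner ℝ x ξ : ℝ) * Complex.I) :=
    funext (planeWave_eq_exp ξ)
  rw [this]
  have h1 : ContDiff ℝ ∞ fun x : EuclideanSpace ℝ (Fin d) => 2 * Real.pi * inner ℝ x ξ :=
    contDiff_const.mul (contDiff_id.inner ℝ contDiff_const)
  exact ((Complex.ofRealCLM.contDiff.comp h1).mul contDiff_const).cexp

theorem continuous_planeWave (ξ : EuclideanSpace ℝ (Fin d)) : Continuous (planeWave ξ) :=
  (contDiff_planeWave ξ).continuous

theorem fderiv_planeWave (ξ x v : EuclideanSpace ℝ (Fin d)) :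
    fderiv ℝ (planeWave ξ) x v = 2 * Real.pi * Complex.I * (inner ℝ v ξ : ℝ) * planeWave ξ x := by
  have h0 : planeWave ξ = fun x => Complex.exp ((2 * Real.pi * inner ℝ x ξ : ℝ) * Complex.I) :=
    funext (planeWave_eq_exp ξ)
  have h1 : HasFDerivAt (fun x : EuclideanSpace ℝ (Fin d) => 2 * Real.pi * inner ℝ x ξ)
      ((2 * Real.pi) • innerSL ℝ ξ) x := by
    have : HasFDerivAt (fun x : EuclideanSpace ℝ (Fin d) => inner ℝ x ξ) (innerSL ℝ ξ) x := by
      have h := (innerSL ℝ ξ).hasFDerivAt (x := x)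
      refine h.congr_of_eventuallyEq (Filter.Eventually.of_forall fun y => ?_)
      simp [real_inner_comm]
    exact this.const_mul _
  have h2 := ((Complex.ofRealCLM.hasFDerivAt.comp x h1).mul_const Complex.I).cexp
  rw [planeWave_eq_exp, h0]
  refine (congrArg (fun A : EuclideanSpace ℝ (Fin d) →L[ℝ] ℂ => A v) h2.fderiv).trans ?_
  simp [real_inner_comm]
  ring

/-- The vector `2πi ξ`. -/
def waveVector (ξ : EuclideanSpace ℝ (Fin d)) : EuclideanSpace ℂ (Fin d) :=
  WithLp.toLp 2 fun i => 2 * Real.pi * Complex.I * (ξ i : ℂ)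

theorem norm_waveVector_sq (ξ : EuclideanSpace ℝ (Fin d)) :
    ‖waveVector ξ‖ ^ 2 = 4 * Real.pi ^ 2 * ‖ξ‖ ^ 2 := by
  rw [EuclideanSpace.norm_sq_eq, EuclideanSpace.norm_sq_eq, Finset.mul_sum]
  refine Finset.sum_congr rfl fun i _ => ?_
  simp [waveVector, mul_pow, abs_of_pos Real.pi_pos]
  norm_num

theorem waveVector_neg (ξ : EuclideanSpace ℝ (Fin d)) : waveVector (-ξ) = -waveVector ξ := by
  ext i; simp [waveVector]

theorem memLp_planeWave_smul (ξ : EuclideanSpace ℝ (Fin d)) {p : ℝ≥0∞}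
    {f : EuclideanSpace ℝ (Fin d) → F} (hf : MemLp f p μ) :
    MemLp (fun x => planeWave ξ x • f x) p μ := by
  refine (memLp_congr_norm ?_ hf.1 (Filter.Eventually.of_forall fun x => ?_)).2 hf
  · exact (continuous_planeWave ξ).aestronglyMeasurable.smul hf.1
  · simp [norm_smul]

/-- Multiplication by the plane wave of frequency `ξ`. -/
def modulate (μ : Measure (EuclideanSpace ℝ (Fin d))) (ξ : EuclideanSpace ℝ (Fin d)) :
    Lp F 2 μ →ₗᵢ[ℂ] Lp F 2 μ where
  toFun f := (memLp_planeWave_smul ξ (Lp.memLp f)).toLp _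
  map_add' f g := by
    rw [← MemLp.toLp_add]
    refine MemLp.toLp_congr _ _ ?_
    filter_upwards [Lp.coeFn_add f g] with x hx
    rw [hx, Pi.add_apply, Pi.add_apply, smul_add]
  map_smul' c f := by
    rw [RingHom.id_apply, ← MemLp.toLp_const_smul]
    refine MemLp.toLp_congr _ _ ?_
    filter_upwards [Lp.coeFn_smul c f] with x hx
    rw [hx, Pi.smul_apply, Pi.smul_apply, smul_comm]
  norm_map' f := by
    rw [LinearMap.coe_mk, AddHom.coe_mk, Lp.norm_toLp, Lp.norm_def]
    congr 1
    refine eLpNorm_congr_norm_ae (Filter.Eventually.of_forall fun x => ?_)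
    simp [norm_smul]

theorem coeFn_modulate (ξ : EuclideanSpace ℝ (Fin d)) (f : Lp F 2 μ) :
    modulate μ ξ f =ᵐ[μ] fun x => planeWave ξ x • f x :=
  (memLp_planeWave_smul ξ (Lp.memLp f)).coeFn_toLp

/-- The action of multiplication by a plane wave on pairs `(u, ∇u)`. -/
def modulatePair (Ω : Set (EuclideanSpace ℝ (Fin d))) (ξ : EuclideanSpace ℝ (Fin d)) :
    WithLp 2 (L2 Ω × L2Vec Ω) →L[ℂ] WithLp 2 (L2 Ω × L2Vec Ω) :=
  (WithLp.prodContinuousLinearEquiv 2 ℂ (L2 Ω) (L2Vec Ω)).symm.toContinuousLinearMap ∘L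
    (((modulate (volume.restrict Ω) ξ).toContinuousLinearMap ∘L WithLp.fstL 2 ℂ _ _).prod
      ((modulate (volume.restrict Ω) ξ).toContinuousLinearMap ∘L
        (WithLp.sndL 2 ℂ _ _ +
          (ContinuousLinearMap.toSpanSingleton ℂ (waveVector ξ)).compLpL 2 (volume.restrict Ω) ∘L
            WithLp.fstL 2 ℂ _ _)))

/-- The function `f(x) v`. -/
def smulVec (f : L2 Ω) (v : EuclideanSpace ℂ (Fin d)) : L2Vec Ω :=
  (ContinuousLinearMap.toSpanSingleton ℂ v).compLpL 2 (volume.restrict Ω) f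

theorem coeFn_smulVec (f : L2 Ω) (v : EuclideanSpace ℂ (Fin d)) :
    smulVec f v =ᵐ[volume.restrict Ω] fun x => f x • v := by
  filter_upwards [ContinuousLinearMap.coeFn_compLpL (p := 2) (μ := volume.restrict Ω)
    (ContinuousLinearMap.toSpanSingleton ℂ v) f] with x hx
  rw [smulVec, hx, ContinuousLinearMap.toSpanSingleton_apply]

theorem modulatePair_fst (ξ : EuclideanSpace ℝ (Fin d)) (p : WithLp 2 (L2 Ω × L2Vec Ω)) :
    (modulatePair Ω ξ p).fst = modulate _ ξ p.fst := rfl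

theorem modulatePair_snd (ξ : EuclideanSpace ℝ (Fin d)) (p : WithLp 2 (L2 Ω × L2Vec Ω)) :
    (modulatePair Ω ξ p).snd = modulate _ ξ (p.snd + smulVec p.fst (waveVector ξ)) := rfl

theorem IsTestFunction.planeWave_mul {ψ : EuclideanSpace ℝ (Fin d) → ℂ}
    (hψ : IsTestFunction Ω ψ) (ξ : EuclideanSpace ℝ (Fin d)) :
    IsTestFunction Ω (planeWave ξ * ψ) :=
  ⟨(contDiff_planeWave ξ).mul hψ.1, hψ.2.1.mul_left, (tsupport_mul_subset_right).trans hψ.2.2⟩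

theorem grad_planeWave_mul {ψ : EuclideanSpace ℝ (Fin d) → ℂ}
    (hψ : IsTestFunction Ω ψ) (ξ x : EuclideanSpace ℝ (Fin d)) :
    grad (planeWave ξ * ψ) x = planeWave ξ x • (grad ψ x + ψ x • waveVector ξ) := by
  ext i
  have h1 : DifferentiableAt ℝ (planeWave ξ) x :=
    (contDiff_planeWave ξ).differentiable (by simp) x
  have h2 : DifferentiableAt ℝ ψ x := hψ.1.differentiable (by simp) x
  simp only [grad, PiLp.smul_apply, PiLp.add_apply, waveVector, smul_eq_mul]
  rw [fderiv_mul h1 h2]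
  simp [fderiv_planeWave, EuclideanSpace.inner_single_left]
  ring

theorem modulatePair_mem_testGraph (ξ : EuclideanSpace ℝ (Fin d))
    {p : WithLp 2 (L2 Ω × L2Vec Ω)} (hp : p ∈ testGraph Ω) : modulatePair Ω ξ p ∈ testGraph Ω := by
  obtain ⟨ψ, hψ, h1, h2⟩ := hp
  refine ⟨planeWave ξ * ψ, hψ.planeWave_mul ξ, ?_, ?_⟩
  · rw [modulatePair_fst]
    filter_upwards [coeFn_modulate ξ p.fst, h1] with x hx hx1
    rw [hx, hx1]; rfl
  · rw [modulatePair_snd]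
    filter_upwards [coeFn_modulate ξ (p.snd + smulVec p.fst (waveVector ξ)), h1, h2,
      Lp.coeFn_add p.snd (smulVec p.fst (waveVector ξ)), coeFn_smulVec p.fst (waveVector ξ)]
      with x hx hx1 hx2 hx3 hx4
    rw [hx, hx3, Pi.add_apply, hx4, hx1, hx2, grad_planeWave_mul hψ]

/-- Multiplication by the plane wave of frequency `ξ` on `H¹₀(Ω)`. -/
def modulateH10 (ξ : EuclideanSpace ℝ (Fin d)) (u : H10 Ω) : H10 Ω :=
  ⟨modulatePair Ω ξ u.1, map_mem_closure (modulatePair Ω ξ).continuous u.2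
    fun _ hp => modulatePair_mem_testGraph ξ hp⟩

theorem toL2_modulateH10 (ξ : EuclideanSpace ℝ (Fin d)) (u : H10 Ω) :
    toL2 (modulateH10 ξ u) = modulate _ ξ (toL2 u) := rfl

theorem weakGrad_modulateH10 (ξ : EuclideanSpace ℝ (Fin d)) (u : H10 Ω) :
    weakGrad (modulateH10 ξ u) = modulate _ ξ (weakGrad u + smulVec (toL2 u) (waveVector ξ)) :=
  rfl

end Modulation

/-! ### `H¹₀(Ω)` as a form domain -/

section FunctionSpace

variable {d : ℕ} (Ω : Set (EuclideanSpace ℝ (Fin d)))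

instance : CompleteSpace (H10 Ω) := by
  unfold H10; infer_instance

/-- The embedding of `H¹₀(Ω)` into `L²(Ω)`. -/
def toL2L : H10 Ω →L[ℂ] L2 Ω := WithLp.fstL 2 ℂ (L2 Ω) (L2Vec Ω) ∘L (H10 Ω).subtypeL

/-- The weak gradient as a bounded operator. -/
def weakGradL : H10 Ω →L[ℂ] L2Vec Ω := WithLp.sndL 2 ℂ (L2 Ω) (L2Vec Ω) ∘L (H10 Ω).subtypeL

variable {Ω}

@[simp] theorem toL2L_apply (u : H10 Ω) : toL2L Ω u = toL2 u := rfl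

@[simp] theorem weakGradL_apply (u : H10 Ω) : weakGradL Ω u = weakGrad u := rfl

theorem H10_inner (u v : H10 Ω) :
    inner ℂ u v = inner ℂ (toL2L Ω u) (toL2L Ω v) + inner ℂ (weakGradL Ω u) (weakGradL Ω v) := rfl

theorem H10_norm_sq (u : H10 Ω) : ‖u‖ ^ 2 = ‖toL2 u‖ ^ 2 + ‖weakGrad u‖ ^ 2 := by
  have := H10_inner u u
  simp only [complex_inner_self] at this
  exact_mod_cast this

/-- The `i`-th component of a vector field. -/
def component (i : Fin d) : L2Vec Ω →L[ℂ] L2 Ω :=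
  (EuclideanSpace.proj i : EuclideanSpace ℂ (Fin d) →L[ℂ] ℂ).compLpL 2 (volume.restrict Ω)

theorem coeFn_component (i : Fin d) (g : L2Vec Ω) :
    component i g =ᵐ[volume.restrict Ω] fun x => g x i :=
  ContinuousLinearMap.coeFn_compLpL (p := 2) (μ := volume.restrict Ω) _ g

theorem norm_sq_eq_sum_component (g : L2Vec Ω) : ‖g‖ ^ 2 = ∑ i, ‖component i g‖ ^ 2 := by
  simp only [L2_norm_sq]
  rw [← integral_finsetSum]
  · refine integral_congr_ae ?_
    filter_upwards [ae_all_iff.2 fun i => coeFn_component i g] with x hx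
    rw [EuclideanSpace.norm_sq_eq]
    exact Finset.sum_congr rfl fun i _ => by rw [hx]
  · intro i _
    exact (memLp_two_iff_integrable_sq_norm (Lp.aestronglyMeasurable _)).1 (Lp.memLp _)

theorem norm_smulVec (f : L2 Ω) (v : EuclideanSpace ℂ (Fin d)) : ‖smulVec f v‖ = ‖f‖ * ‖v‖ := by
  rw [← sq_eq_sq₀ (norm_nonneg _) (by positivity), mul_pow, L2_norm_sq, L2_norm_sq,
    ← integral_mul_const]
  refine integral_congr_ae ?_
  filter_upwards [coeFn_smulVec f v] with x hx
  rw [hx, norm_smul, mul_pow]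

/-- The parallelogram law for the gradients of `exp (±2πi x · ξ) u`. -/
theorem norm_weakGrad_modulateH10_add (ξ : EuclideanSpace ℝ (Fin d)) (u : H10 Ω) :
    ‖weakGrad (modulateH10 ξ u)‖ ^ 2 + ‖weakGrad (modulateH10 (-ξ) u)‖ ^ 2 =
      2 * (‖weakGrad u‖ ^ 2 + 4 * Real.pi ^ 2 * ‖ξ‖ ^ 2 * ‖toL2 u‖ ^ 2) := by
  have h1 : smulVec (toL2 u) (waveVector (-ξ)) = -smulVec (toL2 u) (waveVector ξ) := by
    refine Lp.ext ?_
    filter_upwards [coeFn_smulVec (toL2 u) (waveVector (-ξ)),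
      coeFn_smulVec (toL2 u) (waveVector ξ),
      Lp.coeFn_neg (smulVec (toL2 u) (waveVector ξ))] with x hx hx1 hx2
    rw [hx, hx2, Pi.neg_apply, hx1, waveVector_neg, smul_neg]
  rw [weakGrad_modulateH10, weakGrad_modulateH10, LinearIsometry.norm_map,
    LinearIsometry.norm_map, h1, ← sub_eq_add_neg]
  have h2 := parallelogram_law_with_norm ℂ (weakGrad u) (smulVec (toL2 u) (waveVector ξ))
  have h3 : ‖smulVec (toL2 u) (waveVector ξ)‖ ^ 2
      = 4 * Real.pi ^ 2 * ‖ξ‖ ^ 2 * ‖toL2 u‖ ^ 2 := by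
    rw [norm_smulVec, mul_pow, norm_waveVector_sq]; ring
  rw [← h3]
  linarith

end FunctionSpace

/-! ### Rellich's theorem by Fourier analysis -/

/-- Such a `T` is a norm limit of finite rank operators: with `P` the projection onto the span of
`T† t`, the range of `1 - P` is orthogonal to `T† t`, so `T - T P` has norm at most `ε`. -/
theorem isCompactOperator_of_finite_orthogonality {H L : Type*} [NormedAddCommGroup H]
    [InnerProductSpace ℂ H] [CompleteSpace H] [NormedAddCommGroup L] [InnerProductSpace ℂ L]
    [CompleteSpace L] (T : H →L[ℂ] L)
    (h : ∀ ε > 0, ∃ t : Set L, t.Finite ∧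
      ∀ u, (∀ w ∈ t, inner ℂ w (T u) = 0) → ‖T u‖ ≤ ε * ‖u‖) :
    IsCompactOperator T := by
  have hcl := isClosed_setOfPred_isCompactOperator (𝕜₁ := ℂ) (𝕜₂ := ℂ) (σ₁₂ := RingHom.id ℂ)
    (M₁ := H) (M₂ := L)
  have hmem : T ∈ closure {f : H →L[ℂ] L | IsCompactOperator f} := by
    refine Metric.mem_closure_iff.2 fun ε hε => ?_
    obtain ⟨t, ht, htT⟩ := h (ε / 2) (by positivity)
    set S : Submodule ℂ H := Submodule.span ℂ (ContinuousLinearMap.adjoint T '' t) with hS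
    have : FiniteDimensional ℂ S := FiniteDimensional.span_of_finite ℂ (ht.image _)
    have : ProperSpace S := FiniteDimensional.proper ℂ S
    have hc : IsCompactOperator (S.orthogonalProjectionOnto : H →L[ℂ] S) :=
      isCompactOperator_of_locallyCompactSpace_dom _
    refine ⟨T ∘L S.subtypeL ∘L S.orthogonalProjectionOnto,
      hc.clm_comp (T ∘L S.subtypeL), ?_⟩
    rw [dist_eq_norm]
    refine lt_of_le_of_lt (ContinuousLinearMap.opNorm_le_bound _ (by positivity) fun u => ?_)
      (half_lt_self hε)
    have e : (T - T ∘L S.subtypeL ∘L S.orthogonalProjectionOnto) u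
        = T (u - S.starProjection u) := by
      rw [map_sub]; rfl
    rw [e]
    refine (htT _ fun w hw => ?_).trans ?_
    · rw [← ContinuousLinearMap.adjoint_inner_left]
      exact S.sub_starProjection_mem_orthogonal u _
        (Submodule.subset_span ⟨w, hw, rfl⟩)
    · gcongr
      rw [← Submodule.starProjection_orthogonal_val]
      exact Sᗮ.norm_starProjection_apply_le u
  exact hcl.closure_subset hmem

section FourierSupport

open FourierTransform

variable {d : ℕ} {Ω : Set (EuclideanSpace ℝ (Fin d))}

theorem fourier_indicator (hΩ : MeasurableSet Ω) (f : EuclideanSpace ℝ (Fin d) → ℂ)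
    (ξ : EuclideanSpace ℝ (Fin d)) :
    𝓕 (Ω.indicator f) ξ = ∫ x in Ω, (starRingEnd ℂ) (planeWave ξ x) * f x := by
  rw [Real.fourier_eq, ← integral_indicator hΩ]
  refine integral_congr_ae (Filter.Eventually.of_forall fun x => ?_)
  by_cases hx : x ∈ Ω
  · simp [hx, conj_planeWave, Circle.smul_def]
  · simp [hx]

theorem memLp_indicator_of_memLp (hΩ : MeasurableSet Ω) {f : EuclideanSpace ℝ (Fin d) → ℂ}
    (hf : MemLp f 2 (volume.restrict Ω)) : MemLp (Ω.indicator f) 2 :=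
  (memLp_indicator_iff_restrict hΩ).2 hf

theorem fourier_fderiv_testFunction {ψ : EuclideanSpace ℝ (Fin d) → ℂ}
    (hψ : IsTestFunction Ω ψ) (ξ v : EuclideanSpace ℝ (Fin d)) :
    𝓕 (fun x => fderiv ℝ ψ x v) ξ = 2 * Real.pi * Complex.I * (inner ℝ v ξ : ℝ) * 𝓕 ψ ξ := by
  have hint : Integrable ψ := hψ.1.continuous.integrable_of_hasCompactSupport hψ.2.1
  have hcd : Continuous (fderiv ℝ ψ) := hψ.1.continuous_fderiv (by simp)
  have hint' : Integrable (fderiv ℝ ψ) := hcd.integrable_of_hasCompactSupport (hψ.2.1.fderiv ℝ)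
  have h := Real.fourier_fderiv hint (hψ.1.differentiable (by simp)) hint'
  have h2 := congrArg (fun A : EuclideanSpace ℝ (Fin d) →L[ℝ] ℂ => A v) (congrFun h ξ)
  have h3 := Real.fourier_continuousLinearMap_apply (a := v) (v := ξ) hint'
  simp only [VectorFourier.fourierSMulRight_apply] at h2
  rw [← h3]
  refine h2.trans ?_
  change -(2 * Real.pi * Complex.I) • (-inner ℝ ξ v : ℝ) • 𝓕 ψ ξ = _
  rw [real_inner_comm, Complex.real_smul, smul_eq_mul]
  push_cast
  ring

variable [IsFiniteMeasure (volume.restrict Ω)]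

theorem memLp_planeWave (ξ : EuclideanSpace ℝ (Fin d)) :
    MemLp (planeWave ξ) 2 (volume.restrict Ω) :=
  MemLp.of_bound (continuous_planeWave ξ).aestronglyMeasurable 1
    (Filter.Eventually.of_forall fun x => (norm_planeWave ξ x).le)

/-- The plane wave of frequency `ξ` as an element of `L²(Ω)`. -/
def waveL2 (Ω : Set (EuclideanSpace ℝ (Fin d))) [IsFiniteMeasure (volume.restrict Ω)]
    (ξ : EuclideanSpace ℝ (Fin d)) : L2 Ω := (memLp_planeWave ξ).toLp _

theorem fourier_indicator_eq_inner (hΩ : MeasurableSet Ω) (f : L2 Ω)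
    (ξ : EuclideanSpace ℝ (Fin d)) :
    𝓕 (Ω.indicator f) ξ = inner ℂ (waveL2 Ω ξ) f := by
  rw [fourier_indicator hΩ, L2.inner_def]
  refine integral_congr_ae ?_
  filter_upwards [(memLp_planeWave (Ω := Ω) ξ).coeFn_toLp] with x hx
  rw [waveL2, hx, RCLike.inner_apply, mul_comm]

theorem integrable_indicator_of_memLp (hΩ : MeasurableSet Ω) {f : EuclideanSpace ℝ (Fin d) → ℂ}
    (hf : MemLp f 2 (volume.restrict Ω)) : Integrable (Ω.indicator f) :=
  (integrable_indicator_iff hΩ).2 (hf.integrable one_le_two)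

theorem integrable_norm_fourier_indicator_sq (hΩ : MeasurableSet Ω)
    {f : EuclideanSpace ℝ (Fin d) → ℂ} (hf : MemLp f 2 (volume.restrict Ω)) :
    Integrable fun ξ => ‖𝓕 (Ω.indicator f) ξ‖ ^ 2 := by
  have := memLp_two_fourier (integrable_indicator_of_memLp hΩ hf) (memLp_indicator_of_memLp hΩ hf)
  exact (memLp_two_iff_integrable_sq_norm this.1).1 this

theorem integral_norm_fourier_indicator_sq (hΩ : MeasurableSet Ω)
    {f : EuclideanSpace ℝ (Fin d) → ℂ} (hf : MemLp f 2 (volume.restrict Ω)) :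
    ∫ ξ, ‖𝓕 (Ω.indicator f) ξ‖ ^ 2 = ∫ x in Ω, ‖f x‖ ^ 2 := by
  rw [integral_norm_fourier_sq (integrable_indicator_of_memLp hΩ hf)
    (memLp_indicator_of_memLp hΩ hf), ← integral_indicator hΩ]
  refine integral_congr_ae (Filter.Eventually.of_forall fun x => ?_)
  by_cases hx : x ∈ Ω <;> simp [hx]

theorem integrable_norm_inner_waveL2_sq (hΩ : MeasurableSet Ω) (f : L2 Ω) :
    Integrable fun ξ => ‖inner ℂ (waveL2 Ω ξ) f‖ ^ 2 := by
  simpa only [fourier_indicator_eq_inner hΩ] using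
    integrable_norm_fourier_indicator_sq hΩ (Lp.memLp f)

theorem integral_norm_inner_waveL2_sq (hΩ : MeasurableSet Ω) (f : L2 Ω) :
    ∫ ξ, ‖inner ℂ (waveL2 Ω ξ) f‖ ^ 2 = ‖f‖ ^ 2 := by
  rw [L2_norm_sq, ← integral_norm_fourier_indicator_sq hΩ (Lp.memLp f)]
  simp only [fourier_indicator_eq_inner hΩ]

/-- Differentiation becomes multiplication by `2πi ξ i`. Both sides are continuous in the graph
norm, so it suffices to check test functions, which extend by zero to smooth functions on the whole
space. -/
theorem inner_waveL2_component (hΩ : MeasurableSet Ω) (u : H10 Ω)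
    (ξ : EuclideanSpace ℝ (Fin d)) (i : Fin d) :
    inner ℂ (waveL2 Ω ξ) (component i (weakGrad u)) =
      2 * Real.pi * Complex.I * (ξ i : ℂ) * inner ℂ (waveL2 Ω ξ) (toL2 u) := by
  have hclosed : IsClosed {p : WithLp 2 (L2 Ω × L2Vec Ω) |
      inner ℂ (waveL2 Ω ξ) (component i (WithLp.sndL 2 ℂ (L2 Ω) (L2Vec Ω) p)) =
      2 * Real.pi * Complex.I * (ξ i : ℂ) *
        inner ℂ (waveL2 Ω ξ) (WithLp.fstL 2 ℂ (L2 Ω) (L2Vec Ω) p)} := by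
    refine isClosed_eq ?_ ?_ <;> fun_prop
  refine closure_minimal ?_ hclosed u.2
  rintro p ⟨ψ, hψ, h1, h2⟩
  have hind : ∀ {f g : EuclideanSpace ℝ (Fin d) → ℂ}, f =ᵐ[volume.restrict Ω] g →
      Function.support g ⊆ Ω → 𝓕 (Ω.indicator f) ξ = 𝓕 g ξ := by
    intro f g hfg hg
    have e : Ω.indicator g = g := Set.indicator_eq_self.2 hg
    rw [fourier_indicator hΩ, ← e, fourier_indicator hΩ]
    refine integral_congr_ae ?_
    filter_upwards [hfg] with x hx
    rw [hx]
  have e1 : inner ℂ (waveL2 Ω ξ) p.fst = 𝓕 ψ ξ := by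
    rw [← fourier_indicator_eq_inner hΩ]
    exact hind h1 ((subset_tsupport ψ).trans hψ.2.2)
  have e2 : inner ℂ (waveL2 Ω ξ) (component i p.snd)
      = 𝓕 (fun x => fderiv ℝ ψ x (EuclideanSpace.single i 1)) ξ := by
    rw [← fourier_indicator_eq_inner hΩ]
    refine hind ?_ ?_
    · filter_upwards [coeFn_component i p.snd, h2] with x hx hx2
      rw [hx, hx2]; rfl
    · intro x hx
      refine hψ.2.2 (support_fderiv_subset ℝ (f := ψ) ?_)
      intro h0
      exact hx (by simp [h0])
  have h3 := fourier_fderiv_testFunction hψ ξ (EuclideanSpace.single i 1)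
  rw [← e1, ← e2] at h3
  rw [EuclideanSpace.inner_single_left] at h3
  simpa using h3

theorem sum_norm_inner_waveL2_component_sq (hΩ : MeasurableSet Ω) (u : H10 Ω)
    (ξ : EuclideanSpace ℝ (Fin d)) :
    ∑ i, ‖inner ℂ (waveL2 Ω ξ) (component i (weakGrad u))‖ ^ 2 =
      4 * Real.pi ^ 2 * ‖ξ‖ ^ 2 * ‖inner ℂ (waveL2 Ω ξ) (toL2 u)‖ ^ 2 := by
  rw [EuclideanSpace.norm_sq_eq, Finset.mul_sum, Finset.sum_mul]
  refine Finset.sum_congr rfl fun i _ => ?_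
  rw [inner_waveL2_component hΩ]
  simp only [norm_mul, mul_pow, Complex.norm_real, Complex.norm_I, RCLike.norm_ofNat,
    Real.norm_eq_abs, sq_abs]
  ring

theorem norm_planeWave_sub_le (ξ η x : EuclideanSpace ℝ (Fin d)) :
    ‖planeWave ξ x - planeWave η x‖ ≤ 2 * Real.pi * ‖x‖ * ‖ξ - η‖ := by
  have h : planeWave ξ x = planeWave (ξ - η) x * planeWave η x := by
    rw [planeWave_eq_exp, planeWave_eq_exp, planeWave_eq_exp, ← Complex.exp_add, inner_sub_right]
    congr 1
    push_cast
    ring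
  have h1 : planeWave ξ x - planeWave η x = (planeWave (ξ - η) x - 1) * planeWave η x := by
    rw [h]; ring
  rw [h1, norm_mul, norm_planeWave, mul_one, planeWave_eq_exp, mul_comm _ Complex.I]
  refine (Real.norm_exp_I_mul_ofReal_sub_one_le).trans ?_
  rw [Real.norm_eq_abs, abs_mul, abs_of_pos Real.two_pi_pos, mul_assoc (2 * Real.pi)]
  gcongr
  exact abs_real_inner_le_norm _ _

/-- On a bounded set the plane waves are Lipschitz in the frequency. Hence those with frequency in a
ball form a compact set, which supplies the finite net in Rellich's theorem. -/
theorem continuous_waveL2 (hΩ : MeasurableSet Ω) (hb : Bornology.IsBounded Ω) :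
    Continuous (waveL2 Ω) := by
  obtain ⟨r, hr⟩ := hb.exists_norm_le
  have hlip : ∀ ξ η, dist (waveL2 Ω ξ) (waveL2 Ω η)
      ≤ (2 * Real.pi * |r| * √(volume.real Ω)) * dist ξ η := by
    intro ξ η
    rw [dist_eq_norm, dist_eq_norm, ← abs_of_nonneg (norm_nonneg (waveL2 Ω ξ - waveL2 Ω η))]
    refine abs_le_of_sq_le_sq' ?_ (by positivity) |> fun h => abs_le.2 h
    rw [mul_pow, mul_pow, Real.sq_sqrt measureReal_nonneg, L2_norm_sq]
    have hbound : ∀ᵐ x ∂(volume.restrict Ω), ‖(waveL2 Ω ξ - waveL2 Ω η) x‖ ^ 2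
        ≤ (2 * Real.pi * |r| * ‖ξ - η‖) ^ 2 := by
      filter_upwards [(memLp_planeWave (Ω := Ω) ξ).coeFn_toLp,
        (memLp_planeWave (Ω := Ω) η).coeFn_toLp, Lp.coeFn_sub (waveL2 Ω ξ) (waveL2 Ω η),
        ae_restrict_mem hΩ] with x h1 h2 h3 hx
      rw [h3, Pi.sub_apply, waveL2, waveL2, h1, h2]
      refine pow_le_pow_left₀ (norm_nonneg _) ((norm_planeWave_sub_le ξ η x).trans ?_) 2
      have := (hr x hx).trans (le_abs_self r)
      gcongr
    refine (integral_mono_ae ?_ (integrable_const _) hbound).trans ?_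
    · exact (memLp_two_iff_integrable_sq_norm (Lp.aestronglyMeasurable _)).1 (Lp.memLp _)
    · rw [integral_const, measureReal_restrict_apply_univ, smul_eq_mul]
      exact le_of_eq (by ring)
  exact (LipschitzWith.of_dist_le_mul (K := ⟨2 * Real.pi * |r| * √(volume.real Ω), by positivity⟩)
    hlip).continuous

/-- **Rellich's theorem** for `H¹₀(Ω)`, `Ω` bounded. -/
theorem isCompactOperator_toL2L (hΩ : MeasurableSet Ω) (hb : Bornology.IsBounded Ω) :
    IsCompactOperator (toL2L Ω) := by
  refine isCompactOperator_of_finite_orthogonality _ fun ε hε => ?_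
  -- For frequencies beyond `R`, the mass of `u` is controlled by `ε²` times that of its gradient.
  obtain ⟨R, hR0, hR⟩ : ∃ R : ℝ, 0 < R ∧ 1 / (4 * Real.pi ^ 2 * R ^ 2) ≤ ε ^ 2 := by
    refine ⟨1 / (2 * Real.pi * ε), by positivity, le_of_eq ?_⟩
    field_simp
    norm_num
  set V := volume.real (Metric.closedBall (0 : EuclideanSpace ℝ (Fin d)) R) with hV
  have hV0 : 0 ≤ V := measureReal_nonneg
  -- The low frequencies fill a ball of volume `V`, so a bound `δ‖u‖` on each coefficient costs `V
  -- δ² ‖u‖² ≤ ε² ‖u‖²`. The `+ 1` only keeps the denominator positive.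
  set δ := ε / √(V + 1) with hδ
  have hδ0 : 0 < δ := by positivity
  have hδV : V * δ ^ 2 ≤ ε ^ 2 := by
    rw [hδ, div_pow, Real.sq_sqrt (by positivity), mul_div_assoc', div_le_iff₀ (by positivity)]
    nlinarith [sq_nonneg ε]
  have hcomp := (isCompact_closedBall (0 : EuclideanSpace ℝ (Fin d)) R).image
    (continuous_waveL2 hΩ hb)
  -- If `u` is orthogonal to a `δ`-net of the low-frequency waves, its coefficient against any of
  -- them is at most `δ‖u‖`.
  obtain ⟨t, htf, ht⟩ := Metric.totallyBounded_iff.1 hcomp.totallyBounded δ hδ0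
  refine ⟨t, htf, fun u hu => ?_⟩
  have hlow : ∀ ξ ∈ Metric.closedBall (0 : EuclideanSpace ℝ (Fin d)) R,
      ‖inner ℂ (waveL2 Ω ξ) (toL2 u)‖ ^ 2 ≤ δ ^ 2 * ‖toL2 u‖ ^ 2 := by
    intro ξ hξ
    obtain ⟨w, hw, hwξ⟩ := Set.mem_iUnion₂.1 (ht (Set.mem_image_of_mem _ hξ))
    have h1 : inner ℂ (waveL2 Ω ξ) (toL2 u) = inner ℂ (waveL2 Ω ξ - w) (toL2 u) := by
      rw [inner_sub_left, show inner ℂ w (toL2 u) = 0 from hu w hw, sub_zero]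
    rw [h1, ← mul_pow]
    refine pow_le_pow_left₀ (norm_nonneg _) ((norm_inner_le_norm _ _).trans ?_) 2
    gcongr
    rw [← dist_eq_norm]; exact (Metric.mem_ball.1 hwξ).le
  have hpt : ∀ ξ, ‖inner ℂ (waveL2 Ω ξ) (toL2 u)‖ ^ 2 ≤
      (Metric.closedBall (0 : EuclideanSpace ℝ (Fin d)) R).indicator
        (fun _ => δ ^ 2 * ‖toL2 u‖ ^ 2) ξ +
      ε ^ 2 * ∑ i, ‖inner ℂ (waveL2 Ω ξ) (component i (weakGrad u))‖ ^ 2 := by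
    intro ξ
    by_cases hξ : ξ ∈ Metric.closedBall (0 : EuclideanSpace ℝ (Fin d)) R
    · rw [Set.indicator_of_mem hξ]
      have : 0 ≤ ε ^ 2 * ∑ i, ‖inner ℂ (waveL2 Ω ξ) (component i (weakGrad u))‖ ^ 2 := by
        positivity
      linarith [hlow ξ hξ]
    · rw [Set.indicator_of_notMem hξ, zero_add, sum_norm_inner_waveL2_component_sq hΩ]
      have hξR : R ≤ ‖ξ‖ := by
        rw [Metric.mem_closedBall, dist_zero_right, not_le] at hξ; exact hξ.le
      have h1 : 1 ≤ ε ^ 2 * (4 * Real.pi ^ 2 * ‖ξ‖ ^ 2) := by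
        rw [div_le_iff₀ (by positivity)] at hR
        refine hR.trans ?_
        gcongr
      have := mul_le_mul_of_nonneg_right h1 (sq_nonneg ‖inner ℂ (waveL2 Ω ξ) (toL2 u)‖)
      linarith
  have hint1 : Integrable ((Metric.closedBall (0 : EuclideanSpace ℝ (Fin d)) R).indicator
        (fun _ => δ ^ 2 * ‖toL2 u‖ ^ 2)) :=
    (integrable_indicator_iff Metric.isClosed_closedBall.measurableSet).2
      (integrableOn_const (isCompact_closedBall _ _).measure_lt_top.ne)
  have hint2 : ∀ i ∈ Finset.univ, Integrable fun ξ =>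
      ‖inner ℂ (waveL2 Ω ξ) (component i (weakGrad u))‖ ^ 2 := fun i _ =>
    integrable_norm_inner_waveL2_sq hΩ _
  have hmain := integral_mono (integrable_norm_inner_waveL2_sq hΩ (toL2 u))
    (hint1.add ((integrable_finsetSum _ hint2).const_mul (ε ^ 2))) hpt
  rw [integral_norm_inner_waveL2_sq hΩ] at hmain
  simp only [Pi.add_apply] at hmain
  rw [integral_add hint1 ((integrable_finsetSum _ hint2).const_mul (ε ^ 2)),
    integral_indicator Metric.isClosed_closedBall.measurableSet, setIntegral_const,
    integral_const_mul, integral_finsetSum _ hint2] at hmain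
  simp only [integral_norm_inner_waveL2_sq hΩ, ← norm_sq_eq_sum_component, smul_eq_mul] at hmain
  rw [toL2L_apply]
  refine abs_le_of_sq_le_sq' ?_ (by positivity) |>.2
  rw [mul_pow, H10_norm_sq]
  have := mul_le_mul_of_nonneg_right hδV (sq_nonneg ‖toL2 u‖)
  rw [← hV] at hmain
  linarith

end FourierSupport

/-! ### Existence and identification of the eigenvalues -/

section Eigenvalues

open FourierTransform

variable {d : ℕ} {Ω : Set (EuclideanSpace ℝ (Fin d))}

/-- Read as functions of `ξ`, the coefficients of the trial functions are Fourier transforms; this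
gives access to Riemann–Lebesgue and to Plancherel. -/
theorem inner_modulate (hΩ : MeasurableSet Ω) (w f : L2 Ω) (ξ : EuclideanSpace ℝ (Fin d)) :
    inner ℂ w (modulate _ ξ f) = 𝓕 (Ω.indicator fun x => (starRingEnd ℂ) (w x) * f x) (-ξ) := by
  rw [fourier_indicator hΩ, L2.inner_def]
  refine integral_congr_ae ?_
  filter_upwards [coeFn_modulate ξ f] with x hx
  rw [hx, RCLike.inner_apply, conj_planeWave, inner_neg_right, neg_neg, planeWave, smul_eq_mul]
  ring

/-- The functions `exp (2πi x · ξ) φ` do not all lie in a finite dimensional space. -/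
theorem exists_orthogonal_toL2_ne_zero (hd : 0 < d) (hΩ : MeasurableSet Ω) {φ : H10 Ω}
    (hφ : toL2 φ ≠ 0) {n : ℕ} {u : ℕ → H10 Ω} {μ : ℕ → ℝ}
    (h : IsMinimizingFamily (toL2L Ω) (weakGradL Ω) n u μ) :
    ∃ f, (∀ j < n, inner ℂ (toL2L Ω (u j)) (toL2L Ω f) = 0) ∧ toL2L Ω f ≠ 0 := by
  by_contra! hcon
  -- In positive dimension the space is not compact, so the cocompact filter is nontrivial and
  -- limits along it are unique.
  have : Nonempty (Fin d) := ⟨⟨0, hd⟩⟩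
  -- Otherwise every `exp(2πi x·ξ) φ` would lie in the span of the `u j`. Its coefficients would
  -- have constant square sum `‖φ‖²`, yet each tends to `0` by Riemann–Lebesgue.
  have hconst : ∀ ξ : EuclideanSpace ℝ (Fin d), ‖toL2 φ‖ ^ 2 = ∑ j ∈ Finset.range n,
      ‖inner ℂ (toL2 (u j)) (modulate _ ξ (toL2 φ))‖ ^ 2 := by
    intro ξ
    have h1 := h.norm_sq_eq (modulateH10 ξ φ)
    rw [hcon _ fun j hj => h.inner_sub_spectralProj (modulateH10 ξ φ) hj, norm_zero] at h1
    simpa [toL2_modulateH10] using h1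
  have hlim : Filter.Tendsto (fun ξ : EuclideanSpace ℝ (Fin d) => ∑ j ∈ Finset.range n,
      ‖inner ℂ (toL2 (u j)) (modulate _ ξ (toL2 φ))‖ ^ 2) (Filter.cocompact _)
      (nhds (∑ j ∈ Finset.range n, 0)) := by
    refine tendsto_finsetSum _ fun j _ => ?_
    have h1 := (tendsto_integral_exp_inner_smul_cocompact
      (Ω.indicator fun x => (starRingEnd ℂ) (toL2 (u j) x) * toL2 φ x)).comp
      (Homeomorph.neg (EuclideanSpace ℝ (Fin d))).isClosedEmbedding.tendsto_cocompact
    have h2 := (h1.norm).pow 2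
    rw [norm_zero, zero_pow two_ne_zero] at h2
    refine h2.congr fun ξ => ?_
    rw [inner_modulate hΩ, Real.fourier_eq]
    rfl
  have h0 := tendsto_nhds_unique (tendsto_const_nhds.congr hconst) hlim
  simp only [Finset.sum_const_zero] at h0
  exact hφ (by simpa using h0)

theorem isEigenfunction_iff {u : H10 Ω} {t : ℝ} :
    IsEigenfunction u t ↔ toL2 u ≠ 0 ∧ IsFormEigenvector (toL2L Ω) (weakGradL Ω) u t := by
  simp only [IsEigenfunction, NegLaplacianEq, IsFormEigenvector, inner_smul_right,
    toL2L_apply, weakGradL_apply, ne_eq]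

/-- The minimal values of a minimizing family are the eigenvalues. -/
theorem IsMinimizingFamily.eigenvalue_eq {n : ℕ} {u : ℕ → H10 Ω} {μ : ℕ → ℝ}
    (h : IsMinimizingFamily (toL2L Ω) (weakGradL Ω) (n + 1) u μ) :
    eigenvalue Ω (n + 1) = μ n := by
  -- The infimum is attained, so the default value of `sInf` plays no role.
  refine IsLeast.csInf_eq ⟨?_, ?_⟩
  · refine ⟨fun i => u i, fun i => μ i, ?_, fun i => ⟨?_, h.le (by omega) (by omega)⟩⟩
    · refine Orthonormal.linearIndependent (𝕜 := ℂ) (orthonormal_iff_ite.2 fun i j => ?_)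
      have := h.inner_eq i.2 j.2
      simpa [Fin.ext_iff] using this
    · refine isEigenfunction_iff.2 ⟨fun h0 => ?_, (h i i.2).2.2.1⟩
      have := (h i i.2).1
      rw [toL2L_apply, h0, norm_zero] at this
      exact zero_ne_one this
  · rintro t ⟨v, ν, hv, hν⟩
    by_contra! ht
    classical
    let s : Finset (L2 Ω) := (Finset.range n).image fun j => toL2 (u j)
    -- If `t < μ n`, then `n + 1` independent eigenfunctions would lie in the span of `u 0, …, u (n
    -- - 1)`.
    have hle := linearIndependent_le_span' (fun i => toL2 (v i)) hv (s : Set (L2 Ω)) (by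
      rintro _ ⟨i, rfl⟩
      have h1 := h.mem_span_of_lt (isEigenfunction_iff.1 (hν i).1).2 ((hν i).2.trans_lt ht)
      simp only [toL2L_apply] at h1
      change toL2 (v i) ∈ Submodule.span ℂ (s : Set (L2 Ω))
      rw [h1, ← toL2L_apply, spectralProj, map_sum]
      refine Submodule.sum_mem _ fun j hj => ?_
      rw [map_smul]
      exact Submodule.smul_mem _ _ (Submodule.subset_span
        (Finset.mem_coe.2 (Finset.mem_image_of_mem (fun j => toL2 (u j)) hj))))
    have hs : s.card ≤ n := Finset.card_image_le.trans (Finset.card_range n).le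
    have hc : (Cardinal.mk (Fin (n + 1))) ≤ (s.card : Cardinal) := by
      simpa using hle
    rw [Cardinal.mk_fin] at hc
    have : n + 1 ≤ s.card := by exact_mod_cast hc
    omega

theorem IsMinimizingFamily.eigenvalueMean_eq {n : ℕ} {u : ℕ → H10 Ω} {μ : ℕ → ℝ}
    (h : IsMinimizingFamily (toL2L Ω) (weakGradL Ω) n u μ) :
    eigenvalueMean Ω n = 1 / (n : ℝ) * ∑ j ∈ Finset.range n, μ j := by
  rw [eigenvalueMean, Finset.range_eq_Ico, Finset.sum_Ico_eq_sum_range,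
    ← Finset.Ico_add_one_right_eq_Icc,
    Finset.sum_Ico_eq_sum_range]
  congr 1
  simp only [Nat.add_sub_cancel, Nat.sub_zero, zero_add]
  refine Finset.sum_congr rfl fun j hj => ?_
  rw [add_comm]
  exact (h.mono (Finset.mem_range.1 hj)).eigenvalue_eq

end Eigenvalues

/-! ### Averaging the variational principle over frequencies -/

section Averaging

open FourierTransform

variable {d : ℕ} {Ω : Set (EuclideanSpace ℝ (Fin d))}

theorem ae_norm_le_supNorm {φ : H10 Ω} (hφ : MemLp (toL2 φ) ∞ (volume.restrict Ω)) :
    ∀ᵐ x ∂(volume.restrict Ω), ‖toL2 φ x‖ ≤ supNorm φ := by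
  have h := ae_le_eLpNormEssSup (f := toL2 φ) (μ := volume.restrict Ω)
  filter_upwards [h] with x hx
  rw [← eLpNorm_exponent_top] at hx
  have := ENNReal.toReal_mono hφ.2.ne hx
  simpa [supNorm] using this

theorem supNorm_pos {φ : H10 Ω} (hφ : MemLp (toL2 φ) ∞ (volume.restrict Ω))
    (h0 : toL2 φ ≠ 0) : 0 < supNorm φ := by
  refine lt_of_le_of_ne ENNReal.toReal_nonneg fun h => h0 ?_
  refine (Lp.eq_zero_iff_ae_eq_zero).2 ?_
  filter_upwards [ae_norm_le_supNorm hφ] with x hx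
  rw [← h] at hx
  simpa using hx

theorem memLp_conj_mul {φ : H10 Ω} (hφ : MemLp (toL2 φ) ∞ (volume.restrict Ω)) (w : L2 Ω) :
    MemLp (fun x => (starRingEnd ℂ) (w x) * toL2 φ x) 2 (volume.restrict Ω) := by
  refine (Lp.memLp w).of_le_mul (c := supNorm φ)
    ((RCLike.continuous_conj.comp_aestronglyMeasurable (Lp.aestronglyMeasurable w)).mul
      (Lp.aestronglyMeasurable _)) ?_
  filter_upwards [ae_norm_le_supNorm hφ] with x hx
  rw [norm_mul, RCLike.norm_conj, mul_comm]
  gcongr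

variable [IsFiniteMeasure (volume.restrict Ω)]

theorem integrable_norm_inner_modulate_sq (hΩ : MeasurableSet Ω) {φ : H10 Ω}
    (hφ : MemLp (toL2 φ) ∞ (volume.restrict Ω)) (w : L2 Ω) :
    Integrable fun ξ => ‖inner ℂ w (modulate _ ξ (toL2 φ))‖ ^ 2 := by
  simp only [inner_modulate hΩ]
  exact (integrable_norm_fourier_indicator_sq hΩ (memLp_conj_mul hφ w)).comp_neg

/-- By Plancherel the integral equals `∫_Ω |w|² |φ|²`. Only here is the size of `‖φ‖_∞` used. -/
theorem integral_norm_inner_modulate_sq_le (hΩ : MeasurableSet Ω) {φ : H10 Ω}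
    (hφ : MemLp (toL2 φ) ∞ (volume.restrict Ω)) (w : L2 Ω) :
    ∫ ξ, ‖inner ℂ w (modulate _ ξ (toL2 φ))‖ ^ 2 ≤ supNorm φ ^ 2 * ‖w‖ ^ 2 := by
  simp only [inner_modulate hΩ]
  rw [integral_neg_eq_self fun ξ =>
      ‖𝓕 (Ω.indicator fun x => (starRingEnd ℂ) (w x) * toL2 φ x) ξ‖ ^ 2,
    integral_norm_fourier_indicator_sq hΩ (memLp_conj_mul hφ w), L2_norm_sq w,
    ← integral_const_mul]
  refine integral_mono_ae ?_ ?_ ?_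
  · exact (memLp_two_iff_integrable_sq_norm (memLp_conj_mul hφ w).1).1 (memLp_conj_mul hφ w)
  · exact ((memLp_two_iff_integrable_sq_norm (Lp.aestronglyMeasurable w)).1
      (Lp.memLp w)).const_mul _
  · filter_upwards [ae_norm_le_supNorm hφ] with x hx
    rw [norm_mul, RCLike.norm_conj, mul_comm, mul_pow]
    gcongr

/-- The averaged variational principle, for the trial functions `exp (2πi x · ξ) φ`, `|ξ| < R`. -/
theorem IsMinimizingFamily.setIntegral_ball_le (hΩ : MeasurableSet Ω) {φ : H10 Ω}
    (hφ : MemLp (toL2 φ) ∞ (volume.restrict Ω)) {n : ℕ} {u : ℕ → H10 Ω} {μ : ℕ → ℝ}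
    (h : IsMinimizingFamily (toL2L Ω) (weakGradL Ω) (n + 1) u μ) {z : ℝ}
    (hz : ∀ j < n, μ j ≤ z) (hz' : z ≤ μ n) (R : ℝ) :
    ∫ ξ in Metric.ball (0 : EuclideanSpace ℝ (Fin d)) R,
      (z * ‖toL2 φ‖ ^ 2 - ‖weakGrad φ‖ ^ 2 - 4 * Real.pi ^ 2 * ‖toL2 φ‖ ^ 2 * ‖ξ‖ ^ 2) ≤
      supNorm φ ^ 2 * ∑ j ∈ Finset.range n, (z - μ j) := by
  set Φ : EuclideanSpace ℝ (Fin d) → ℝ := fun ξ =>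
    ∑ j ∈ Finset.range n, (z - μ j) * ‖inner ℂ (toL2 (u j)) (modulate _ ξ (toL2 φ))‖ ^ 2 with hΦ
  have hterm : ∀ j ∈ Finset.range n, Integrable fun ξ : EuclideanSpace ℝ (Fin d) =>
      (z - μ j) * ‖inner ℂ (toL2 (u j)) (modulate _ ξ (toL2 φ))‖ ^ 2 := fun j _ =>
    (integrable_norm_inner_modulate_sq hΩ hφ _).const_mul _
  have hΦi : Integrable Φ := integrable_finsetSum _ hterm
  have hz0 : ∀ j ∈ Finset.range n, 0 ≤ z - μ j := fun j hj =>
    sub_nonneg.2 (hz j (Finset.mem_range.1 hj))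
  have hΦ0 : ∀ ξ, 0 ≤ Φ ξ := fun ξ =>
    Finset.sum_nonneg fun j hj => mul_nonneg (hz0 j hj) (sq_nonneg _)
  have hΦint : ∫ ξ, Φ ξ ≤ supNorm φ ^ 2 * ∑ j ∈ Finset.range n, (z - μ j) := by
    rw [hΦ, integral_finsetSum _ hterm, Finset.mul_sum]
    refine Finset.sum_le_sum fun j hj => ?_
    rw [integral_const_mul, mul_comm]
    refine mul_le_mul_of_nonneg_right ?_ (hz0 j hj)
    have h1 := integral_norm_inner_modulate_sq_le hΩ hφ (toL2 (u j))
    have h2 : ‖toL2 (u j)‖ = 1 := (h j (Nat.lt_succ_of_lt (Finset.mem_range.1 hj))).1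
    rwa [h2, one_pow, mul_one] at h1
  -- Adding the inequalities for `ξ` and `-ξ` cancels the cross term between `∇φ` and `2πi ξ φ`.
  have hpt : ∀ ξ, 2 * (z * ‖toL2 φ‖ ^ 2 - ‖weakGrad φ‖ ^ 2
      - 4 * Real.pi ^ 2 * ‖toL2 φ‖ ^ 2 * ‖ξ‖ ^ 2) ≤ Φ ξ + Φ (-ξ) := by
    intro ξ
    have h1 := h.mul_norm_sq_sub_le hz' (modulateH10 ξ φ)
    have h2 := h.mul_norm_sq_sub_le hz' (modulateH10 (-ξ) φ)
    simp only [toL2L_apply, weakGradL_apply, toL2_modulateH10, LinearIsometry.norm_map] at h1 h2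
    have h3 := norm_weakGrad_modulateH10_add ξ φ
    change _ ≤ Φ ξ at h1
    change _ ≤ Φ (-ξ) at h2
    linarith
  have hsum : Integrable fun ξ => Φ ξ + Φ (-ξ) := hΦi.add hΦi.comp_neg
  have hcont : Continuous fun ξ : EuclideanSpace ℝ (Fin d) => z * ‖toL2 φ‖ ^ 2 -
      ‖weakGrad φ‖ ^ 2 - 4 * Real.pi ^ 2 * ‖toL2 φ‖ ^ 2 * ‖ξ‖ ^ 2 := by fun_prop
  have hpoly : IntegrableOn (fun ξ : EuclideanSpace ℝ (Fin d) => z * ‖toL2 φ‖ ^ 2 -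
      ‖weakGrad φ‖ ^ 2 - 4 * Real.pi ^ 2 * ‖toL2 φ‖ ^ 2 * ‖ξ‖ ^ 2) (Metric.ball 0 R) :=
    (hcont.continuousOn.integrableOn_compact (isCompact_closedBall 0 R)).mono_set
      Metric.ball_subset_closedBall
  have h1 := setIntegral_mono (s := Metric.ball (0 : EuclideanSpace ℝ (Fin d)) R)
    (hpoly.const_mul 2) hsum.integrableOn hpt
  -- As `z ≥ μ j` makes `Φ` nonnegative, the ball may be enlarged to the whole space, where
  -- Plancherel applies.
  have h2 := setIntegral_le_integral (s := Metric.ball (0 : EuclideanSpace ℝ (Fin d)) R) hsum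
    (Filter.Eventually.of_forall fun ξ => add_nonneg (hΦ0 ξ) (hΦ0 (-ξ)))
  rw [integral_add hΦi hΦi.comp_neg, integral_neg_eq_self] at h2
  rw [integral_const_mul] at h1
  linarith

end Averaging

/-! ### Optimal radius, constants and the quadratic inequality -/

section Constants

theorem unitBallVolume_pos (d : ℕ) : 0 < unitBallVolume d :=
  div_pos (Real.rpow_pos_of_pos Real.pi_pos _) (Real.Gamma_pos_of_pos (by positivity))

theorem volume_real_ball_one {d : ℕ} (hd : 0 < d) :
    volume.real (Metric.ball (0 : EuclideanSpace ℝ (Fin d)) 1) = unitBallVolume d := by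
  have : Nonempty (Fin d) := ⟨⟨0, hd⟩⟩
  have h : √Real.pi ^ d / Real.Gamma ((d : ℝ) / 2 + 1) = unitBallVolume d := by
    rw [unitBallVolume, add_comm, Real.sqrt_eq_rpow, ← Real.rpow_natCast, ← Real.rpow_mul
      Real.pi_pos.le]
    congr 2
    ring
  rw [Measure.real, EuclideanSpace.volume_ball, Fintype.card_fin, h]
  simp [(unitBallVolume_pos d).le]

theorem setIntegral_ball_sub_mul_norm_sq {d : ℕ} (hd : 0 < d) (a b : ℝ) {R : ℝ} (hR : 0 ≤ R) :
    ∫ ξ in Metric.ball (0 : EuclideanSpace ℝ (Fin d)) R, (a - b * ‖ξ‖ ^ 2) =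
      unitBallVolume d * R ^ d * (a - b * (d / (d + 2)) * R ^ 2) := by
  have : Nonempty (Fin d) := ⟨⟨0, hd⟩⟩
  have h1 : ∫ ξ in Metric.ball (0 : EuclideanSpace ℝ (Fin d)) R, (a - b * ‖ξ‖ ^ 2) =
      ∫ ξ : EuclideanSpace ℝ (Fin d), (Set.Iio R).indicator (fun r => a - b * r ^ 2) ‖ξ‖ := by
    rw [← integral_indicator measurableSet_ball]
    refine integral_congr_ae (Filter.Eventually.of_forall fun ξ => ?_)
    simp [Set.indicator]
  have h2 : ∫ y in Set.Ioi (0 : ℝ), y ^ (d - 1) •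
      (Set.Iio R).indicator (fun r => a - b * r ^ 2) y =
      ∫ y in (0 : ℝ)..R, (a * y ^ (d - 1) - b * y ^ (d + 1)) := by
    rw [intervalIntegral.integral_of_le hR, integral_Ioc_eq_integral_Ioo,
      ← integral_indicator measurableSet_Ioi, ← integral_indicator measurableSet_Ioo]
    refine integral_congr_ae (Filter.Eventually.of_forall fun y => ?_)
    have hpow : y ^ (d + 1) = y ^ (d - 1) * y ^ 2 := by
      rw [← pow_add]; congr 1; omega
    by_cases h0 : 0 < y <;> by_cases hyR : y < R <;> simp [h0, hyR, Set.indicator, hpow]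
    ring
  rw [h1, integral_fun_norm_addHaar, finrank_euclideanSpace_fin, volume_real_ball_one hd, h2,
    intervalIntegral.integral_sub
      (Continuous.intervalIntegrable (by fun_prop) _ _)
      (Continuous.intervalIntegrable (by fun_prop) _ _),
    intervalIntegral.integral_const_mul, intervalIntegral.integral_const_mul, integral_pow,
    integral_pow]
  have hd' : ((d - 1 : ℕ) : ℝ) + 1 = d := by
    have : d - 1 + 1 = d := by omega
    exact_mod_cast this
  have hd0 : (d : ℝ) ≠ 0 := by exact_mod_cast hd.ne'
  rw [show d - 1 + 1 = d by omega, hd', zero_pow hd.ne', zero_pow (by omega)]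
  rw [nsmul_eq_mul, smul_eq_mul]
  have hd2 : (d : ℝ) + 2 ≠ 0 := by positivity
  have hd3 : (d : ℝ) + 1 + 1 ≠ 0 := by positivity
  push_cast
  rw [show d + 1 + 1 = d + 2 by omega, pow_add, show (d : ℝ) + 1 + 1 = d + 2 by ring]
  field_simp
  ring

variable {d : ℕ} {Ω : Set (EuclideanSpace ℝ (Fin d))}

/-- The scale is used only through this identity, free of fractional powers of the constants; the
factors `|Ω|` from `k/|Ω|` and from `ρ(φ)` cancel. -/
theorem weylScale_rpow (hd : 0 < d) {φ : H10 Ω} {k : ℕ} (hk : 0 < k) (hV : 0 < volume.real Ω)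
    (hφ : toL2 φ ≠ 0) (hM : 0 < supNorm φ) :
    0 < weylScale φ k ∧ weylScale φ k ^ ((d : ℝ) / 2) * (unitBallVolume d * ‖toL2 φ‖ ^ 2) =
      (2 * Real.pi) ^ d * (k * supNorm φ ^ 2) := by
  have hA : 0 < ‖toL2 φ‖ := norm_pos_iff.2 hφ
  have hω := unitBallVolume_pos d
  have hd0 : (d : ℝ) ≠ 0 := by exact_mod_cast hd.ne'
  have hk0 : (0 : ℝ) < k := by exact_mod_cast hk
  have hρ : 0 < rho φ := by unfold rho; positivity
  have hC : 0 < classicalConst d := by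
    unfold classicalConst
    have := Real.pi_pos
    positivity
  refine ⟨by unfold weylScale; positivity, ?_⟩
  have e1 : ∀ x : ℝ, 0 < x → (x ^ (2 / (d : ℝ))) ^ ((d : ℝ) / 2) = x := fun x hx => by
    rw [← Real.rpow_mul hx.le, show 2 / (d : ℝ) * (d / 2) = 1 by field_simp, Real.rpow_one]
  have e2 : ∀ x : ℝ, 0 < x → (x ^ (-(2 / (d : ℝ)))) ^ ((d : ℝ) / 2) = x⁻¹ := fun x hx => by
    rw [← Real.rpow_mul hx.le, show -(2 / (d : ℝ)) * (d / 2) = -1 by field_simp,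
      Real.rpow_neg_one]
  have e3 : (4 * Real.pi ^ 2) ^ ((d : ℝ) / 2) = (2 * Real.pi) ^ d := by
    rw [show 4 * Real.pi ^ 2 = (2 * Real.pi) ^ (2 : ℝ) by
      rw [Real.rpow_two]; ring, ← Real.rpow_mul Real.two_pi_pos.le,
      show (2 : ℝ) * (d / 2) = d by ring, Real.rpow_natCast]
  have hkV : 0 < (k : ℝ) / volume.real Ω := by positivity
  rw [weylScale, Real.mul_rpow (by positivity) (by positivity),
    Real.mul_rpow (by positivity) (by positivity), classicalConst,
    Real.mul_rpow (by positivity) (by positivity), e1 _ hkV, e2 _ hρ, e2 _ hω, e3, rho]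
  field_simp

/-- The upper bound for `z ∈ [λ_k, λ_{k+1}]` obtained by optimizing the radius of the ball. -/
theorem IsMinimizingFamily.rpow_le (hd : 0 < d) (hΩ : MeasurableSet Ω)
    [IsFiniteMeasure (volume.restrict Ω)] (hV : 0 < volume.real Ω) {φ : H10 Ω}
    (hφ : MemLp (toL2 φ) ∞ (volume.restrict Ω)) (hφ0 : toL2 φ ≠ 0) {k : ℕ} (hk : 0 < k)
    {u : ℕ → H10 Ω} {μ : ℕ → ℝ}
    (h : IsMinimizingFamily (toL2L Ω) (weakGradL Ω) (k + 1) u μ) {z : ℝ}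
    (hz : ∀ j < k, μ j ≤ z) (hz' : z ≤ μ k) (hzG : rayleigh φ ≤ z) :
    2 / ((d : ℝ) + 2) * ((z - rayleigh φ) / weylScale φ k) *
      ((z - rayleigh φ) / weylScale φ k) ^ ((d : ℝ) / 2) ≤
      (z - eigenvalueMean Ω k) / weylScale φ k := by
  obtain ⟨hS, hSd⟩ := weylScale_rpow hd hk hV hφ0 (supNorm_pos hφ hφ0)
  have hM := supNorm_pos hφ hφ0
  have hA : 0 < ‖toL2 φ‖ := norm_pos_iff.2 hφ0
  have hω := unitBallVolume_pos d
  have hk0 : (0 : ℝ) < k := by exact_mod_cast hk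
  set y := z - rayleigh φ with hy
  have hy0 : 0 ≤ y := sub_nonneg.2 hzG
  -- This is the largest ball on which the integrand `‖φ‖² (y - 4π²|ξ|²)` is nonnegative, hence the
  -- optimal one.
  set R := √y / (2 * Real.pi) with hR
  have hR0 : 0 ≤ R := by have := Real.pi_pos; positivity
  have hR2 : 4 * Real.pi ^ 2 * R ^ 2 = y := by
    rw [hR, div_pow, Real.sq_sqrt hy0]
    have := Real.pi_pos
    field_simp
    ring
  have hRd : (2 * Real.pi) ^ d * R ^ d = y ^ ((d : ℝ) / 2) := by
    rw [← mul_pow, hR, mul_div_cancel₀ _ Real.two_pi_pos.ne', Real.sqrt_eq_rpow,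
      ← Real.rpow_natCast, ← Real.rpow_mul hy0]
    congr 1
    ring
  have hmain := h.setIntegral_ball_le hΩ hφ hz hz' R
  rw [setIntegral_ball_sub_mul_norm_sq hd _ _ hR0] at hmain
  have hB : ‖weakGrad φ‖ ^ 2 = rayleigh φ * ‖toL2 φ‖ ^ 2 := by
    rw [rayleigh, div_mul_cancel₀ _ (by positivity)]
  have hsum : ∑ j ∈ Finset.range k, (z - μ j) = k * (z - eigenvalueMean Ω k) := by
    rw [(h.mono (Nat.le_succ k)).eigenvalueMean_eq, Finset.sum_sub_distrib, Finset.sum_const,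
      Finset.card_range, nsmul_eq_mul]
    field_simp
  -- The factor `2/(d+2)` is `1 - d/(d+2)`, where `d/(d+2)` is the mean of `|ξ|²/R²` over the ball.
  have hfac : z * ‖toL2 φ‖ ^ 2 - ‖weakGrad φ‖ ^ 2 -
      4 * Real.pi ^ 2 * ‖toL2 φ‖ ^ 2 * (d / (d + 2)) * R ^ 2
      = ‖toL2 φ‖ ^ 2 * (2 / ((d : ℝ) + 2) * y) := by
    rw [hB, show 4 * Real.pi ^ 2 * ‖toL2 φ‖ ^ 2 * (d / ((d : ℝ) + 2)) * R ^ 2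
      = ‖toL2 φ‖ ^ 2 * (d / ((d : ℝ) + 2)) * (4 * Real.pi ^ 2 * R ^ 2) by ring, hR2]
    have : (d : ℝ) + 2 ≠ 0 := by positivity
    field_simp
    rw [hy]
    ring
  rw [hfac, hsum] at hmain
  have hmain2 : (unitBallVolume d * ‖toL2 φ‖ ^ 2) * (2 / ((d : ℝ) + 2) * y * y ^ ((d : ℝ) / 2)) ≤
      (weylScale φ k ^ ((d : ℝ) / 2) * (unitBallVolume d * ‖toL2 φ‖ ^ 2)) *
        (z - eigenvalueMean Ω k) := by
    rw [hSd, ← hRd]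
    have := mul_le_mul_of_nonneg_left hmain (pow_nonneg Real.two_pi_pos.le d)
    linarith
  have hmain3 : 2 / ((d : ℝ) + 2) * y * y ^ ((d : ℝ) / 2) ≤
      weylScale φ k ^ ((d : ℝ) / 2) * (z - eigenvalueMean Ω k) := by
    refine le_of_mul_le_mul_left ?_ (by positivity : 0 < unitBallVolume d * ‖toL2 φ‖ ^ 2)
    linarith
  have hSp : 0 < weylScale φ k ^ ((d : ℝ) / 2) := Real.rpow_pos_of_pos hS _
  rw [Real.div_rpow hy0 hS.le, le_div_iff₀ hS, show 2 / ((d : ℝ) + 2) * (y / weylScale φ k) *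
    (y ^ ((d : ℝ) / 2) / weylScale φ k ^ ((d : ℝ) / 2)) * weylScale φ k =
    2 / ((d : ℝ) + 2) * y * y ^ ((d : ℝ) / 2) / weylScale φ k ^ ((d : ℝ) / 2) by field_simp,
    div_le_iff₀ hSp]
  linarith

/-- The convexity inequality that turns the power bound into a quadratic one. -/
theorem sub_one_sq_le_of_rpow_le {δ y m : ℝ} (hδ : 2 ≤ δ) (hy : 0 ≤ y)
    (h : 2 / (δ + 2) * y * y ^ (δ / 2) ≤ y - m) : (y - 1) ^ 2 ≤ 1 - (δ + 2) / δ * m := by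
  -- The tangent line of `y^{δ/2}` at `y = 1` lies below the graph because `δ ≥ 2` makes the
  -- exponent at least `1`.
  have hbern := one_add_mul_self_le_rpow_one_add (s := y - 1) (by linarith)
    (p := δ / 2) (by linarith)
  rw [add_sub_cancel] at hbern
  have h1 := mul_le_mul_of_nonneg_left hbern hy
  have h2 : 2 * (y * y ^ (δ / 2)) ≤ (δ + 2) * (y - m) := by
    rw [mul_assoc, div_mul_eq_mul_div, div_le_iff₀ (by linarith)] at h
    linarith
  have h3 : (δ + 2) / δ * m * δ = (δ + 2) * m := by field_simp
  have hδ0 : 0 < δ := by linarith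
  have h4 : δ * (y - 1) ^ 2 ≤ δ * (1 - (δ + 2) / δ * m) := by nlinarith
  exact le_of_mul_le_mul_left h4 hδ0

theorem IsMinimizingFamily.sub_one_sq_le_radicand (hd : 2 ≤ d) (hΩ : MeasurableSet Ω)
    [IsFiniteMeasure (volume.restrict Ω)] (hV : 0 < volume.real Ω) {φ : H10 Ω}
    (hφ : MemLp (toL2 φ) ∞ (volume.restrict Ω)) (hφ0 : toL2 φ ≠ 0) {k : ℕ} (hk : 0 < k)
    {u : ℕ → H10 Ω} {μ : ℕ → ℝ}
    (h : IsMinimizingFamily (toL2L Ω) (weakGradL Ω) (k + 1) u μ) {z : ℝ}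
    (hz : ∀ j < k, μ j ≤ z) (hz' : z ≤ μ k) (hzG : rayleigh φ ≤ z) :
    ((z - rayleigh φ) / weylScale φ k - 1) ^ 2 ≤ radicand φ k := by
  have hS := (weylScale_rpow (by omega) hk hV hφ0 (supNorm_pos hφ hφ0)).1
  have h1 := h.rpow_le (by omega) hΩ hV hφ hφ0 hk hz hz' hzG
  have h2 := sub_one_sq_le_of_rpow_le (δ := d) (m := (eigenvalueMean Ω k - rayleigh φ) /
    weylScale φ k) (by exact_mod_cast hd) (div_nonneg (sub_nonneg.2 hzG) hS.le)
    (h1.trans (le_of_eq (by rw [← sub_div]; congr 1; ring)))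
  rwa [mul_div_assoc'] at h2

theorem between_of_sub_one_sq_le {G S z r : ℝ} (hS : 0 < S) (h : ((z - G) / S - 1) ^ 2 ≤ r) :
    G + S * (1 - √r) ≤ z ∧ z ≤ G + S * (1 + √r) := by
  have h1 := abs_le.1 (Real.abs_le_sqrt h)
  have h2 : z = G + S * ((z - G) / S) := by field_simp; ring
  constructor
  · calc G + S * (1 - √r) ≤ G + S * ((z - G) / S) := by gcongr; linarith
      _ = z := h2.symm
  · calc z = G + S * ((z - G) / S) := h2
      _ ≤ _ := by gcongr; linarith

end Constants

end DirichletLaplacian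

end

/-! ### The two-sided bound -/

theorem mainTheorem12 (d : ℕ) (hd : 2 ≤ d) (Ω : Set (EuclideanSpace ℝ (Fin d)))
    (hΩ_open : IsOpen Ω) (hΩ_nonempty : Ω.Nonempty) (hΩ_bdd : Bornology.IsBounded Ω)
    (φ : DirichletLaplacian.H10 Ω) (hφ_ne : DirichletLaplacian.toL2 φ ≠ 0)
    (hφ_bdd : MemLp (DirichletLaplacian.toL2 φ) ∞ (volume.restrict Ω))
    (k : ℕ) (hk : 1 ≤ k)
    (hφk : DirichletLaplacian.rayleigh φ ≤ DirichletLaplacian.eigenvalue Ω k) :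
    0 ≤ DirichletLaplacian.radicand φ k ∧
    DirichletLaplacian.rayleigh φ +
        DirichletLaplacian.weylScale φ k * DirichletLaplacian.xMinus φ k
      ≤ DirichletLaplacian.eigenvalue Ω k ∧
    DirichletLaplacian.eigenvalue Ω k ≤ DirichletLaplacian.eigenvalue Ω (k + 1) ∧
    DirichletLaplacian.eigenvalue Ω (k + 1)
      ≤ DirichletLaplacian.rayleigh φ +
        DirichletLaplacian.weylScale φ k * DirichletLaplacian.xPlus φ k := by
  open DirichletLaplacian in
  have hm := hΩ_open.measurableSet
  have hfin : volume Ω < ⊤ := hΩ_bdd.measure_lt_top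
  have : IsFiniteMeasure (volume.restrict Ω) := ⟨by rwa [Measure.restrict_apply_univ]⟩
  have hV : 0 < volume.real Ω :=
    ENNReal.toReal_pos (hΩ_open.measure_pos volume hΩ_nonempty).ne' hfin.ne
  obtain ⟨u, μ, h⟩ := exists_isMinimizingFamily (isCompactOperator_toL2L hm hΩ_bdd) H10_inner
    (fun n u μ h => exists_orthogonal_toL2_ne_zero (by omega) hm hφ_ne h) (k + 1)
  -- The family is indexed from `0`, so `λ_k` is `μ l` with `k = l + 1`.
  obtain ⟨l, rfl⟩ : ∃ l, k = l + 1 := ⟨k - 1, by omega⟩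
  have e1 : eigenvalue Ω (l + 1) = μ l := (h.mono (Nat.le_succ _)).eigenvalue_eq
  have e2 : eigenvalue Ω (l + 1 + 1) = μ (l + 1) := h.eigenvalue_eq
  have hle : μ l ≤ μ (l + 1) := h.le (Nat.le_succ l) (Nat.lt_succ_self _)
  rw [e1] at hφk
  have hS := (weylScale_rpow (k := l + 1) (by omega) hk hV hφ_ne (supNorm_pos hφ_bdd hφ_ne)).1
  -- The quadratic inequality at the two endpoints: `z = λ_k` in `b1`, `z = λ_{k+1}` in `b2`.
  have b1 := h.sub_one_sq_le_radicand hd hm hV hφ_bdd hφ_ne hk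
    (fun j hj => h.le (by omega) (by omega)) hle hφk
  have b2 := h.sub_one_sq_le_radicand hd hm hV hφ_bdd hφ_ne hk
    (fun j hj => h.le (by omega) (by omega)) le_rfl (hφk.trans hle)
  rw [e1, e2]
  exact ⟨(sq_nonneg _).trans b1, (between_of_sub_one_sq_le hS b1).1, hle,
    (between_of_sub_one_sq_le hS b2).2⟩
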